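/- Let $(X,d)$ be a compact metric space and $\mu$ a Borel probability measure on $X$ with $\mu(U)>0$ for every nonempty open $U$. Let $(\mathcal E,\operatorname{Dom}\mathcal E)$ be a symmetric, regular, strictly local Dirichlet form on $L^2(X,\mu)$ (strictly local: $\mathcal E(u,v)=0$ whenever $u,v\in\operatorname{Dom}\mathcal E$ have compact supports and $v$ is constant on a neighbourhood of the support of $u$), with nonpositive self-adjoint generator $\Delta$ and heat semigroup $P_t=e^{t\Delta}$. Assume that $\mathcal E$ admits a carré du champ, that is, a nonnegative symmetric continuous bilinear map $\Gamma:\operatorname{Dom}\mathcal E\times\operatorname{Dom}\mathcal E\to L^1(X,\mu)$ with $2\int h\,\Gamma(f,g)\,d\mu=\mathcal E(fh,g)+\mathcal E(gh,f)-\mathcal E(h,fg)$ for all bounded $f,g,h\in\operatorname{Dom}\mathcal E$; write $\Gamma(f)=\Gamma(f,f)$. Let $\mathcal B_b(X)$ be the bounded Borel functions on $X$ and $\mathcal C=C_b(X)\cap\operatorname{Dom}\mathcal E$. Let $\mathcal H$ be the Hilbert space of one-forms, i.e. the Hausdorff completion of $\mathcal C\otimes\mathcal B_b(X)$ for $\langle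 f_1\otimes g_1,f_2\otimes g_2\rangle_{\mathcal H}=\int g_1g_2\Gamma(f_1,f_2)\,d\mu$. Let $\langle\cdot,\cdot\rangle_{\mathcal H_x}$ be the fibrewise scalar product, i.e. the continuous bilinear map $\mathcal H\times\mathcal H\to L^1(X,\mu)$ with $\langle f_1\otimes g_1,f_2\otimes g_2\rangle_{\mathcal H_x}=g_1(x)g_2(x)\Gamma(f_1,f_2)(x)$, and let $\|\eta\|_{\mathcal H_x}=\langle\eta,\eta\rangle_{\mathcal H_x}^{1/2}$. Let $\partial:L^2(X,\mu)\supseteq\operatorname{Dom}\mathcal E\to\mathcal H$ be the closure of $f\mapsto f\otimes\mathbf 1$, $f\in\mathcal C$, let $\partial^*$ be its adjoint, and let $\vec P_t=e^{t\vec\Delta}$, where $\vec\Delta=-\partial\partial^*$ with domain $\{\eta\in\operatorname{Dom}\partial^* : \partial^*\eta\in\operatorname{Dom}\partial\}$. Let $C_1\ge 1$, and assume the semigroup domination $$\|\vec P_t\eta\|_{\mathcal H_x}\le C_1\,(P_t\|\eta\|_{\mathcal H_\cdot})(x)\quad\text{for }\mu\text{-a.e. }x,\qquad \eta\in\mathcal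 H,\ 0\le t\le 1,$$ and the weak Bakry–Émery estimate $\sqrt{\Gamma(P_tf)}\le C_1e^{C_2t}P_t\sqrt{\Gamma(f)}$ ($\mu$-a.e., for all $f\in\operatorname{Dom}\mathcal E$ and $t\ge0$) with $C_2=0$, that is, $$\sqrt{\Gamma(P_tf)}\le C_1\,P_t\sqrt{\Gamma(f)}\quad\mu\text{-a.e.},\qquad f\in\operatorname{Dom}\mathcal E,\ t\ge0.$$ Put $$\operatorname{Var}f=\sup\{\langle f,\partial^*\eta\rangle_{L^2} : \eta\in\operatorname{Dom}\partial^*,\ \|\eta\|_{\mathcal H_x}\le1\text{ for }\mu\text{-a.e. }x\}$$ and $BV(X)=\{f\in\mathcal B_b(X) : \operatorname{Var}f<\infty\}$. Then for every $f\in BV(X)$ and every $t\ge0$, $$\|P_tf-f\|_{L^1(X,\mu)}\le C_1^3\sqrt{2t}\,\operatorname{Var}f.$$ -/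

import Mathlib

open MeasureTheory Filter Topology
open scoped ENNReal TensorProduct

noncomputable section

namespace DirichletSpace

/-! ### Semigroups generated by unbounded operators -/

section Operators

variable {H : Type*} [NormedAddCommGroup H] [InnerProductSpace ℝ H]

/-- `R` is the bounded two-sided inverse `(l - A)⁻¹` of `l - A : Dom A → H`. -/
def IsResolvent (A : H →ₗ.[ℝ] H) (l : ℝ) (R : H →L[ℝ] H) : Prop :=
  (∀ y : H, ∃ x : A.domain, (x : H) = R y ∧ l • (x : H) - A x = y) ∧
    ∀ x : A.domain, R (l • (x : H) - A x) = x

open scoped Classical in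
/-- The resolvent `(l - A)⁻¹` (the value is `0` if `l` is not in the resolvent set). -/
def resolventOp (A : H →ₗ.[ℝ] H) (l : ℝ) : H →L[ℝ] H :=
  if h : ∃ R, IsResolvent A l R then h.choose else 0

/-- The Yosida approximation `A_l = l A (l - A)⁻¹ = l (l (l - A)⁻¹ - 1)` of `A`. -/
def yosida (A : H →ₗ.[ℝ] H) (l : ℝ) : H →L[ℝ] H :=
  l • (l • resolventOp A l - 1)

/-- The strongly continuous semigroup `e^{tA}`, by the Hille-Yosida construction
`e^{tA} x = lim_{l → ∞} e^{t A_l} x`.  For a nonpositive self-adjoint operator `A` (the only case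
that is used) the limit exists for every `x` and every `t ≥ 0`. -/
def expSemigroup (A : H →ₗ.[ℝ] H) (t : ℝ) (x : H) : H :=
  limUnder atTop (fun l : ℝ => NormedSpace.exp (t • yosida A l) x)

/-- The composition `S ∘ T` of unbounded operators, with its natural domain
`{x ∈ Dom T | T x ∈ Dom S}`. -/
def compPMap {K L : Type*} [NormedAddCommGroup K] [InnerProductSpace ℝ K]
    [NormedAddCommGroup L] [InnerProductSpace ℝ L]
    (S : K →ₗ.[ℝ] L) (T : H →ₗ.[ℝ] K) : H →ₗ.[ℝ] L where
  domain := (S.domain.comap T.toFun).map T.domain.subtype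
  toFun :=
    { toFun := fun x => S ⟨T ⟨x, by
          obtain ⟨y, -, hy⟩ := x.2
          rw [← hy]; exact y.2⟩, by
          obtain ⟨y, hy, hyx⟩ := x.2
          have : (⟨x, by rw [← hyx]; exact y.2⟩ : T.domain) = y := Subtype.ext hyx.symm
          rw [this]; exact hy⟩
      map_add' := fun x y => by
        rw [← LinearPMap.map_add]
        exact congrArg S (Subtype.ext (T.toFun.map_add ⟨x, _⟩ ⟨y, _⟩))
      map_smul' := fun c x => by
        rw [RingHom.id_apply, ← LinearPMap.map_smul]
        exact congrArg S (Subtype.ext (T.toFun.map_smul c ⟨x, _⟩)) }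

end Operators

/-! ### Bounded measurable functions and square roots -/

/-- The algebra `B_b(X)` of bounded measurable real functions. -/
def BddMeas (X : Type*) [MeasurableSpace X] : Subalgebra ℝ (X → ℝ) where
  carrier := {g | Measurable g ∧ ∃ C : ℝ, ∀ x, |g x| ≤ C}
  mul_mem' := by
    rintro f g ⟨hf, C, hC⟩ ⟨hg, D, hD⟩
    refine ⟨hf.mul hg, C * D, fun x => ?_⟩
    rw [Pi.mul_apply, abs_mul]
    exact mul_le_mul (hC x) (hD x) (abs_nonneg _) ((abs_nonneg _).trans (hC x))
  add_mem' := by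
    rintro f g ⟨hf, C, hC⟩ ⟨hg, D, hD⟩
    refine ⟨hf.add hg, C + D, fun x => ?_⟩
    exact (abs_add_le _ _).trans (add_le_add (hC x) (hD x))
  algebraMap_mem' := fun r => ⟨measurable_const, |r|, fun x => le_refl _⟩

variable {X : Type*} [MeasurableSpace X] {μ : Measure X}

theorem BddMeas.memLp (f : BddMeas X) (p : ℝ≥0∞) (μ : Measure X) [IsFiniteMeasure μ] :
    MemLp (f : X → ℝ) p μ := by
  obtain ⟨C, hC⟩ := f.2.2
  exact MemLp.of_bound f.2.1.aestronglyMeasurable C (Eventually.of_forall hC)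

/-- The class in `L²(X, μ)` of a bounded measurable function (`μ` finite). -/
def BddMeas.toL2 (μ : Measure X) [IsFiniteMeasure μ] (f : BddMeas X) : Lp ℝ 2 μ :=
  (BddMeas.memLp f 2 μ).toLp (f : X → ℝ)

theorem BddMeas.memLp_top (f : BddMeas X) (μ : Measure X) : MemLp (f : X → ℝ) ∞ μ := by
  obtain ⟨C, hC⟩ := f.2.2
  exact memLp_top_of_bound f.2.1.aestronglyMeasurable C (Eventually.of_forall hC)

/-- The linear map `B_b(X) → L^∞(X, μ)`. -/
def BddMeas.toLinfty (μ : Measure X) : BddMeas X →ₗ[ℝ] Lp ℝ ∞ μ where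
  toFun f := (BddMeas.memLp_top f μ).toLp (f : X → ℝ)
  map_add' f g := MemLp.toLp_add (BddMeas.memLp_top f μ) (BddMeas.memLp_top g μ)
  map_smul' c f := MemLp.toLp_const_smul c (BddMeas.memLp_top f μ)

/-- Pointwise multiplication `B_b(X) × L¹(X, μ) → L¹(X, μ)`. -/
def mulL1 (μ : Measure X) : BddMeas X →ₗ[ℝ] Lp ℝ 1 μ →ₗ[ℝ] Lp ℝ 1 μ :=
  ((ContinuousLinearMap.mul ℝ ℝ).holderₗ μ ∞ 1 1).comp (BddMeas.toLinfty μ)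

theorem coeFn_mulL1 (g : BddMeas X) (F : Lp ℝ 1 μ) :
    mulL1 μ g F =ᵐ[μ] fun x => (g : X → ℝ) x * F x := by
  have h1 := ContinuousLinearMap.coeFn_holder (r := 1) (ContinuousLinearMap.mul ℝ ℝ)
    (BddMeas.toLinfty μ g) F
  have h2 : BddMeas.toLinfty μ g =ᵐ[μ] (g : X → ℝ) :=
    MemLp.coeFn_toLp (BddMeas.memLp_top g μ)
  filter_upwards [h1, h2] with x hx hx2
  rw [← hx2]
  exact hx

theorem memLp_two_sqrt (F : Lp ℝ 1 μ) : MemLp (fun x => Real.sqrt (F x)) 2 μ := by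
  have hm : AEStronglyMeasurable (fun x => Real.sqrt (F x)) μ :=
    Real.continuous_sqrt.comp_aestronglyMeasurable (Lp.aestronglyMeasurable F)
  rw [memLp_two_iff_integrable_sq hm]
  have hF : Integrable F μ := memLp_one_iff_integrable.1 (Lp.memLp F)
  refine hF.mono (hm.pow 2) (Eventually.of_forall fun x => ?_)
  rw [Real.norm_eq_abs, Real.norm_eq_abs, abs_of_nonneg (sq_nonneg _)]
  rcases le_total 0 (F x) with h | h
  · rw [Real.sq_sqrt h]; exact le_abs_self _
  · rw [Real.sqrt_eq_zero_of_nonpos h]; simp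

/-- The square root `√F ∈ L²` of a nonnegative function `F ∈ L¹`. -/
def sqrtL2 (F : Lp ℝ 1 μ) : Lp ℝ 2 μ := (memLp_two_sqrt F).toLp _

/-! ### Dirichlet forms -/

/-- A symmetric Dirichlet form on `L²(X, μ)`: a densely defined, closed, nonnegative symmetric
bilinear form which is Markovian (the unit contraction operates). -/
structure DirichletForm (μ : Measure X) where
  domain : Submodule ℝ (Lp ℝ 2 μ)
  form : domain →ₗ[ℝ] domain →ₗ[ℝ] ℝ
  dense : Dense (domain : Set (Lp ℝ 2 μ))
  symm : ∀ u v, form u v = form v u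
  nonneg : ∀ u, 0 ≤ form u u
  closed : ∀ u : ℕ → domain,
    (∀ ε > 0, ∃ N, ∀ m ≥ N, ∀ n ≥ N,
      ‖(u m : Lp ℝ 2 μ) - u n‖ ^ 2 + form (u m - u n) (u m - u n) < ε) →
    ∃ v : domain, Tendsto
      (fun n => ‖(u n : Lp ℝ 2 μ) - v‖ ^ 2 + form (u n - v) (u n - v)) atTop (𝓝 0)
  markov : ∀ u : domain, ∃ v : domain,
    (v : Lp ℝ 2 μ) =ᵐ[μ] (fun x => min (max ((u : Lp ℝ 2 μ) x) 0) 1) ∧ form v v ≤ form u u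

namespace DirichletForm

variable (E : DirichletForm μ)

/-- `E₁(u, u) = ‖u‖₂² + E(u, u)`. -/
def energyOne (u : E.domain) : ℝ := ‖(u : Lp ℝ 2 μ)‖ ^ 2 + E.form u u

/-- The graph of the generator: the pairs `(u, w)` with `u ∈ Dom E` and
`E(u, φ) = - ⟨w, φ⟩` for all `φ ∈ Dom E`. -/
def generatorGraph : Submodule ℝ (Lp ℝ 2 μ × Lp ℝ 2 μ) where
  carrier := {p | ∃ h : p.1 ∈ E.domain, ∀ φ : E.domain,
    E.form ⟨p.1, h⟩ φ = - inner ℝ p.2 (φ : Lp ℝ 2 μ)}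
  zero_mem' := ⟨E.domain.zero_mem, fun φ => by
    have : (⟨(0 : Lp ℝ 2 μ × Lp ℝ 2 μ).1, E.domain.zero_mem⟩ : E.domain) = 0 := rfl
    rw [this]; simp⟩
  add_mem' := by
    rintro p q ⟨hp, hp'⟩ ⟨hq, hq'⟩
    refine ⟨E.domain.add_mem hp hq, fun φ => ?_⟩
    have : (⟨(p + q).1, E.domain.add_mem hp hq⟩ : E.domain) = ⟨p.1, hp⟩ + ⟨q.1, hq⟩ := rfl
    rw [this, map_add, LinearMap.add_apply, hp', hq', Prod.snd_add, inner_add_left]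
    ring
  smul_mem' := by
    rintro c p ⟨hp, hp'⟩
    refine ⟨E.domain.smul_mem c hp, fun φ => ?_⟩
    have : (⟨(c • p).1, E.domain.smul_mem c hp⟩ : E.domain) = c • ⟨p.1, hp⟩ := rfl
    rw [this, map_smul, LinearMap.smul_apply, hp', Prod.smul_snd, real_inner_smul_left]
    simp

/-- The (nonpositive, self-adjoint) generator `Δ` of the form. -/
def generator : Lp ℝ 2 μ →ₗ.[ℝ] Lp ℝ 2 μ := E.generatorGraph.toLinearPMap

/-- The heat semigroup `P_t = e^{tΔ}` on `L²(X, μ)`. -/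
def heat (t : ℝ) (f : Lp ℝ 2 μ) : Lp ℝ 2 μ := expSemigroup E.generator t f

section Topological

variable [TopologicalSpace X]

/-- The form is regular: `C_c(X) ∩ Dom E` is dense in `Dom E` for the `E₁`-norm and dense in
`C_c(X)` for the uniform norm. -/
def IsRegular : Prop :=
  (∀ u : E.domain, ∀ ε > 0, ∃ (φ : X → ℝ) (v : E.domain), Continuous φ ∧ HasCompactSupport φ ∧
    (v : Lp ℝ 2 μ) =ᵐ[μ] φ ∧ E.energyOne (u - v) < ε) ∧
  (∀ φ : X → ℝ, Continuous φ → HasCompactSupport φ → ∀ ε > 0, ∃ (ψ : X → ℝ) (v : E.domain),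
    Continuous ψ ∧ HasCompactSupport ψ ∧ (v : Lp ℝ 2 μ) =ᵐ[μ] ψ ∧ ∀ x, |φ x - ψ x| < ε)

/-- The support of an almost everywhere defined function: the complement of the largest open set
on which it vanishes almost everywhere (up to null sets, for second countable `X`). -/
def aeSupport (u : Lp ℝ 2 μ) : Set X :=
  {x | ∀ V ∈ 𝓝 x, ¬ ∀ᵐ y ∂μ, y ∈ V → u y = 0}

/-- The form is strictly (strongly) local: `E(u, v) = 0` whenever `u, v ∈ Dom E` have compact
supports and `v` is constant on a neighbourhood of the support of `u`. -/
def IsStrictlyLocal : Prop :=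
  ∀ u v : E.domain, IsCompact (aeSupport (u : Lp ℝ 2 μ)) → IsCompact (aeSupport (v : Lp ℝ 2 μ)) →
    (∃ (U : Set X) (c : ℝ), IsOpen U ∧ aeSupport (u : Lp ℝ 2 μ) ⊆ U ∧
      ∀ᵐ x ∂μ, x ∈ U → (v : Lp ℝ 2 μ) x = c) →
    E.form u v = 0

/-- `C = C_b(X) ∩ Dom E`, as a subspace of `Dom E`. -/
def contDomain : Submodule ℝ E.domain where
  carrier := {u | ∃ φ : BoundedContinuousFunction X ℝ, (u : Lp ℝ 2 μ) =ᵐ[μ] φ}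
  zero_mem' := ⟨0, Lp.coeFn_zero ℝ 2 μ⟩
  add_mem' := by
    rintro u v ⟨φ, hφ⟩ ⟨ψ, hψ⟩
    exact ⟨φ + ψ, (Lp.coeFn_add (u : Lp ℝ 2 μ) v).trans (hφ.add hψ)⟩
  smul_mem' := by
    rintro c u ⟨φ, hφ⟩
    exact ⟨c • φ, (Lp.coeFn_smul c (u : Lp ℝ 2 μ)).trans (hφ.const_smul c)⟩

end Topological

/-- Essential boundedness of a class of functions. -/
def EssBounded (u : Lp ℝ 2 μ) : Prop := ∃ C : ℝ, ∀ᵐ x ∂μ, |u x| ≤ C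

end DirichletForm

open DirichletForm

/-- A carré du champ of the Dirichlet form `E`: the (unique) nonnegative symmetric continuous
bilinear map `Γ : Dom E × Dom E → L¹(X, μ)` with
`2 ∫ h Γ(f, g) dμ = E(f h, g) + E(g h, f) - E(h, f g)` for all bounded `f, g, h ∈ Dom E`,
which is the weak form of `Γ(f, g) = ½ (Δ(f g) - f Δ g - g Δ f)`. -/
structure CarreDuChamp (E : DirichletForm μ) where
  gamma : E.domain →ₗ[ℝ] E.domain →ₗ[ℝ] Lp ℝ 1 μ
  symm : ∀ f g, gamma f g = gamma g f
  nonneg : ∀ f, ∀ᵐ x ∂μ, 0 ≤ gamma f f x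
  continuous : ∃ C : ℝ, ∀ f g,
    ‖gamma f g‖ ≤ C * (Real.sqrt (E.energyOne f) * Real.sqrt (E.energyOne g))
  integral_eq : ∀ f g h fg fh gh : E.domain,
    EssBounded (f : Lp ℝ 2 μ) → EssBounded (g : Lp ℝ 2 μ) → EssBounded (h : Lp ℝ 2 μ) →
    (fg : Lp ℝ 2 μ) =ᵐ[μ] (fun x => (f : Lp ℝ 2 μ) x * (g : Lp ℝ 2 μ) x) →
    (fh : Lp ℝ 2 μ) =ᵐ[μ] (fun x => (f : Lp ℝ 2 μ) x * (h : Lp ℝ 2 μ) x) →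
    (gh : Lp ℝ 2 μ) =ᵐ[μ] (fun x => (g : Lp ℝ 2 μ) x * (h : Lp ℝ 2 μ) x) →
    2 * ∫ x, (h : Lp ℝ 2 μ) x * gamma f g x ∂μ = E.form fh g + E.form gh f - E.form h fg

/-! ### One-forms -/

namespace CarreDuChamp

theorem coeFn_sum {ι : Type*} (s : Finset ι) (F : ι → Lp ℝ 1 μ) :
    (∑ i ∈ s, F i : Lp ℝ 1 μ) =ᵐ[μ] fun x => ∑ i ∈ s, F i x := by
  classical
  induction s using Finset.induction_on with
  | empty => simp only [Finset.sum_empty]; exact Lp.coeFn_zero ℝ 1 μ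
  | insert a s ha ih =>
    rw [Finset.sum_insert ha]
    filter_upwards [Lp.coeFn_add (F a) (∑ i ∈ s, F i), ih] with x h1 h2
    rw [h1, Pi.add_apply, h2, Finset.sum_insert ha]

theorem gamma_posSemidef {E : DirichletForm μ} (G : CarreDuChamp E) {k : ℕ}
    (f : Fin k → E.domain) :
    ∀ᵐ x ∂μ, ∀ c : Fin k → ℝ, 0 ≤ ∑ i, ∑ j, c i * c j * G.gamma (f i) (f j) x := by
  have hq : ∀ᵐ x ∂μ, ∀ q : Fin k → ℚ,
      0 ≤ ∑ i, ∑ j, (q i : ℝ) * (q j : ℝ) * G.gamma (f i) (f j) x := by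
    rw [ae_all_iff]
    intro q
    have h1 := G.nonneg (∑ i, (q i : ℝ) • f i)
    have h2 : G.gamma (∑ i, (q i : ℝ) • f i) (∑ i, (q i : ℝ) • f i) =
        ∑ p : Fin k × Fin k, ((q p.1 : ℝ) * (q p.2 : ℝ)) • G.gamma (f p.1) (f p.2) := by
      rw [Fintype.sum_prod_type]
      simp only [map_sum, LinearMap.sum_apply, map_smul, LinearMap.smul_apply,
        Finset.smul_sum, smul_smul]
      rw [Finset.sum_comm]
      refine Finset.sum_congr rfl fun i _ => Finset.sum_congr rfl fun j _ => ?_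
      rw [mul_comm]
    rw [h2] at h1
    have h3 : ∀ᵐ x ∂μ, ∀ p : Fin k × Fin k,
        (((q p.1 : ℝ) * (q p.2 : ℝ)) • G.gamma (f p.1) (f p.2) : Lp ℝ 1 μ) x =
          (q p.1 : ℝ) * (q p.2 : ℝ) * G.gamma (f p.1) (f p.2) x := by
      rw [ae_all_iff]
      intro p
      exact Lp.coeFn_smul _ _
    filter_upwards [h1, h3, coeFn_sum Finset.univ fun p : Fin k × Fin k =>
      ((q p.1 : ℝ) * (q p.2 : ℝ)) • G.gamma (f p.1) (f p.2)] with x hx1 hx3 hx2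
    rw [hx2, Fintype.sum_prod_type] at hx1
    simpa only [fun i j => hx3 (i, j)] using hx1
  filter_upwards [hq] with x hx c
  have hd : DenseRange (fun q : Fin k → ℚ => fun i => (q i : ℝ)) :=
    DenseRange.piMap fun _ => Rat.denseRange_cast
  refine hd.induction_on c (isClosed_le continuous_const (by fun_prop)) fun q => hx q

variable [TopologicalSpace X] {E : DirichletForm μ} (G : CarreDuChamp E)

/-- The algebraic tensor product `C ⊗ B_b(X)`. -/
def PreForms (_G : CarreDuChamp E) : Type _ := E.contDomain ⊗[ℝ] BddMeas X

instance : AddCommGroup G.PreForms := inferInstanceAs (AddCommGroup (E.contDomain ⊗[ℝ] BddMeas X))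
instance : Module ℝ G.PreForms := inferInstanceAs (Module ℝ (E.contDomain ⊗[ℝ] BddMeas X))

/-- The simple tensor `f ⊗ g`. -/
def tmul (f : E.contDomain) (g : BddMeas X) : G.PreForms := f ⊗ₜ[ℝ] g

/-- The pointwise (fibrewise) scalar product on `C ⊗ B_b(X)`, the bilinear map with values in
`L¹(X, μ)` determined by `⟨f₁ ⊗ g₁, f₂ ⊗ g₂⟩ = g₁ g₂ Γ(f₁, f₂)`. -/
def preFiber : G.PreForms →ₗ[ℝ] G.PreForms →ₗ[ℝ] Lp ℝ 1 μ :=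
  (LinearMap.BilinMap.tmul (R := ℝ) (A := ℝ)
    (G.gamma.compl₁₂ E.contDomain.subtype E.contDomain.subtype)
    (LinearMap.mul ℝ (BddMeas X))).compr₂ (TensorProduct.lift (mulL1 μ).flip)

theorem preFiber_tmul (f₁ f₂ : E.contDomain) (g₁ g₂ : BddMeas X) :
    G.preFiber (G.tmul f₁ g₁) (G.tmul f₂ g₂) = mulL1 μ (g₁ * g₂) (G.gamma f₁ f₂) := rfl

theorem preFiber_symm (a b : G.PreForms) : G.preFiber a b = G.preFiber b a := by
  have h := LinearMap.BilinMap.tmul_isSymm (R := ℝ) (A := ℝ)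
    (B₁ := G.gamma.compl₁₂ E.contDomain.subtype E.contDomain.subtype)
    (B₂ := LinearMap.mul ℝ (BddMeas X))
    (fun x y => G.symm _ _) (fun x y => mul_comm x y) a b
  exact congrArg (TensorProduct.lift (mulL1 μ).flip) h

theorem preFiber_nonneg (a : G.PreForms) : ∀ᵐ x ∂μ, 0 ≤ G.preFiber a a x := by
  obtain ⟨k, f, g, rfl⟩ : ∃ (k : ℕ) (f : Fin k → E.contDomain) (g : Fin k → BddMeas X),
      a = ∑ i, G.tmul (f i) (g i) := TensorProduct.exists_sum_tmul_eq a
  have h2 : G.preFiber (∑ i, G.tmul (f i) (g i)) (∑ i, G.tmul (f i) (g i)) =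
      ∑ p : Fin k × Fin k, mulL1 μ (g p.1 * g p.2) (G.gamma (f p.1) (f p.2)) := by
    rw [Fintype.sum_prod_type]
    simp only [map_sum, LinearMap.sum_apply, preFiber_tmul]
    rw [Finset.sum_comm]
  rw [h2]
  have h3 : ∀ᵐ x ∂μ, ∀ p : Fin k × Fin k,
      mulL1 μ (g p.1 * g p.2) (G.gamma (f p.1) (f p.2)) x =
        (g p.1 : X → ℝ) x * (g p.2 : X → ℝ) x * G.gamma (f p.1) (f p.2) x := by
    rw [ae_all_iff]
    intro p
    exact coeFn_mulL1 _ _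
  filter_upwards [h3, G.gamma_posSemidef fun i => (f i : E.domain),
    coeFn_sum Finset.univ fun p : Fin k × Fin k =>
      mulL1 μ (g p.1 * g p.2) (G.gamma (f p.1) (f p.2))] with x hx3 hx1 hx2
  rw [hx2, Fintype.sum_prod_type]
  simpa only [fun i j => hx3 (i, j)] using hx1 fun i => (g i : X → ℝ) x

/-- The scalar product `⟨f₁ ⊗ g₁, f₂ ⊗ g₂⟩ = ∫ g₁ g₂ Γ(f₁, f₂) dμ` on `C ⊗ B_b(X)`. -/
instance : PreInnerProductSpace.Core ℝ G.PreForms where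
  inner a b := ∫ x, G.preFiber a b x ∂μ
  conj_inner_symm a b := by rw [preFiber_symm]; rfl
  re_inner_nonneg a := integral_nonneg_of_ae (G.preFiber_nonneg a)
  add_left a b c := by
    rw [map_add, LinearMap.add_apply, integral_congr_ae (Lp.coeFn_add _ _)]
    exact integral_add (L1.integrable_coeFn _) (L1.integrable_coeFn _)
  smul_left a b r := by
    rw [map_smul, LinearMap.smul_apply, integral_congr_ae (Lp.coeFn_smul _ _)]
    exact integral_const_mul _ _

instance : SeminormedAddCommGroup G.PreForms :=
  InnerProductSpace.Core.toSeminormedAddCommGroup (𝕜 := ℝ)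

instance : InnerProductSpace ℝ G.PreForms := .ofCore _

theorem inner_preForms (a b : G.PreForms) : inner ℝ a b = ∫ x, G.preFiber a b x ∂μ := rfl

/-- The Hilbert space `H` of (`L²`) one-forms: the Hausdorff completion of `C ⊗ B_b(X)`. -/
abbrev OneForms : Type _ := UniformSpace.Completion G.PreForms

theorem norm_preFiber_le (a b : G.PreForms) : ‖G.preFiber a b‖ ≤ 1 * ‖a‖ * ‖b‖ := by
  -- `2 |⟨a, b⟩_x| ≤ s |a|_x² + s⁻¹ |b|_x²` for every `s > 0`; integrate and optimise over `s`
  have hpos : ∀ c : G.PreForms, ∫ x, G.preFiber c c x ∂μ = ‖c‖ ^ 2 := fun c => by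
    rw [← real_inner_self_eq_norm_sq]; rfl
  have key : ∀ s : ℝ, 0 < s → 2 * ‖G.preFiber a b‖ ≤ s * ‖a‖ ^ 2 + s⁻¹ * ‖b‖ ^ 2 := by
    intro s hs
    have hexp : ∀ r : ℝ, G.preFiber (s • a + r • b) (s • a + r • b) =
        (s ^ 2) • G.preFiber a a + ((2 * s * r) • G.preFiber a b +
          (r ^ 2) • G.preFiber b b) := by
      intro r
      simp only [map_add, map_smul, LinearMap.add_apply, LinearMap.smul_apply,
        G.preFiber_symm b a]
      module
    have hpt : ∀ r : ℝ, ∀ᵐ x ∂μ, 0 ≤ s ^ 2 * G.preFiber a a x +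
        (2 * s * r * G.preFiber a b x + r ^ 2 * G.preFiber b b x) := by
      intro r
      have h := G.preFiber_nonneg (s • a + r • b)
      rw [hexp r] at h
      filter_upwards [h, Lp.coeFn_add ((s ^ 2) • G.preFiber a a)
          ((2 * s * r) • G.preFiber a b + (r ^ 2) • G.preFiber b b),
        Lp.coeFn_add ((2 * s * r) • G.preFiber a b) ((r ^ 2) • G.preFiber b b),
        Lp.coeFn_smul (s ^ 2) (G.preFiber a a), Lp.coeFn_smul (2 * s * r) (G.preFiber a b),
        Lp.coeFn_smul (r ^ 2) (G.preFiber b b)] with x h0 h1 h2 h3 h4 h5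
      rw [h1, Pi.add_apply, h2, Pi.add_apply, h3, h4, h5] at h0
      simpa using h0
    have hab : ∀ᵐ x ∂μ, 2 * ‖G.preFiber a b x‖ ≤
        s * G.preFiber a a x + s⁻¹ * G.preFiber b b x := by
      filter_upwards [hpt 1, hpt (-1)] with x h1 h2
      have e : s * G.preFiber a a x + s⁻¹ * G.preFiber b b x =
          s⁻¹ * (s ^ 2 * G.preFiber a a x + G.preFiber b b x) := by field_simp
      rw [e, Real.norm_eq_abs, le_inv_mul_iff₀ hs]
      rcases abs_cases (G.preFiber a b x) with ⟨h, -⟩ | ⟨h, -⟩ <;> rw [h] <;> linarith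
    have hint := fun c d : G.PreForms => L1.integrable_coeFn (G.preFiber c d)
    calc 2 * ‖G.preFiber a b‖ = ∫ x, 2 * ‖G.preFiber a b x‖ ∂μ := by
          rw [integral_const_mul, L1.norm_eq_integral_norm]
      _ ≤ ∫ x, (s * G.preFiber a a x + s⁻¹ * G.preFiber b b x) ∂μ :=
          integral_mono_ae ((hint a b).norm.const_mul 2)
            (((hint a a).const_mul s).add ((hint b b).const_mul s⁻¹)) hab
      _ = s * ‖a‖ ^ 2 + s⁻¹ * ‖b‖ ^ 2 := by
          rw [integral_add ((hint a a).const_mul s) ((hint b b).const_mul s⁻¹),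
            integral_const_mul, integral_const_mul, hpos, hpos]
  rw [one_mul]
  have lim : Tendsto (fun e : ℝ => (‖a‖ + e) * (‖b‖ + e)) (𝓝[>] 0) (𝓝 (‖a‖ * ‖b‖)) := by
    have : Tendsto (fun e : ℝ => (‖a‖ + e) * (‖b‖ + e)) (𝓝 0)
        (𝓝 ((‖a‖ + 0) * (‖b‖ + 0))) := Continuous.tendsto (by fun_prop) 0
    rw [add_zero, add_zero] at this
    exact this.mono_left nhdsWithin_le_nhds
  refine ge_of_tendsto lim (eventually_nhdsWithin_of_forall fun e (he : 0 < e) => ?_)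
  have ha := norm_nonneg a
  have hb := norm_nonneg b
  have h := key ((‖b‖ + e) / (‖a‖ + e)) (by positivity)
  have h1 : (‖b‖ + e) / (‖a‖ + e) * ‖a‖ ^ 2 ≤ (‖a‖ + e) * (‖b‖ + e) := by
    rw [div_mul_eq_mul_div, div_le_iff₀ (by positivity)]
    have : ‖a‖ ^ 2 ≤ (‖a‖ + e) ^ 2 := by gcongr; linarith
    nlinarith [mul_le_mul_of_nonneg_left this (by positivity : 0 ≤ ‖b‖ + e)]
  have h2 : ((‖b‖ + e) / (‖a‖ + e))⁻¹ * ‖b‖ ^ 2 ≤ (‖a‖ + e) * (‖b‖ + e) := by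
    rw [inv_div, div_mul_eq_mul_div, div_le_iff₀ (by positivity)]
    have : ‖b‖ ^ 2 ≤ (‖b‖ + e) ^ 2 := by gcongr; linarith
    nlinarith [mul_le_mul_of_nonneg_left this (by positivity : 0 ≤ ‖a‖ + e)]
  linarith

/-- The fibrewise scalar product `(η, ζ) ↦ ⟨η, ζ⟩_{H_x}`, as a bilinear map from `H × H` to
`L¹(X, μ)`: the continuous extension of the one on `C ⊗ B_b(X)`. -/
def fiberInner : G.OneForms →L[ℝ] G.OneForms →L[ℝ] Lp ℝ 1 μ :=
  let B : G.PreForms →L[ℝ] G.PreForms →L[ℝ] Lp ℝ 1 μ :=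
    LinearMap.mkContinuous₂ G.preFiber 1 G.norm_preFiber_le
  let e : G.PreForms →L[ℝ] G.OneForms := UniformSpace.Completion.toComplL
  ((B.extend e).flip.extend e).flip

theorem fiberInner_coe (a b : G.PreForms) :
    G.fiberInner (a : G.OneForms) (b : G.OneForms) = G.preFiber a b := by
  have hd : DenseRange (UniformSpace.Completion.toComplL :
      G.PreForms →L[ℝ] G.OneForms) := UniformSpace.Completion.denseRange_coe
  have hu : IsUniformInducing (UniformSpace.Completion.toComplL :
      G.PreForms →L[ℝ] G.OneForms) := UniformSpace.Completion.isUniformInducing_coe _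
  have h2 := fun f : G.PreForms →L[ℝ] G.PreForms →L[ℝ] Lp ℝ 1 μ => f.extend_eq hd hu
  have h3 := fun f : G.PreForms →L[ℝ] G.OneForms →L[ℝ] Lp ℝ 1 μ => f.extend_eq hd hu
  simp only [UniformSpace.Completion.coe_toComplL] at h2 h3
  simp only [fiberInner, ContinuousLinearMap.flip_apply, h2, h3,
    LinearMap.mkContinuous₂_apply]

theorem inner_eq_integral_fiberInner (η ζ : G.OneForms) :
    inner ℝ η ζ = ∫ x, G.fiberInner η ζ x ∂μ := by
  have hL : ∀ F : Lp ℝ 1 μ, ∫ x, F x ∂μ = L1.integralCLM F := fun F => by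
    rw [← L1.integral_eq_integral, L1.integral_def]
  rw [hL]
  induction η, ζ using UniformSpace.Completion.induction_on₂ with
  | hp => exact isClosed_eq (by fun_prop) (by fun_prop)
  | ih a b =>
    rw [fiberInner_coe, ← hL, UniformSpace.Completion.inner_coe]
    rfl

/-- The fibrewise norm `x ↦ ‖η‖_{H_x}`, an element of `L²(X, μ)`. -/
def fiberNorm (η : G.OneForms) : Lp ℝ 2 μ := sqrtL2 (G.fiberInner η η)

/-- The exterior derivative on `C`: `f ↦ f ⊗ 1`. -/
def derivCont : E.contDomain →ₗ[ℝ] G.OneForms where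
  toFun f := (G.tmul f 1 : G.PreForms)
  map_add' f g := by
    rw [← UniformSpace.Completion.coe_add]
    exact congrArg _ (TensorProduct.add_tmul f g (1 : BddMeas X))
  map_smul' c f := by
    rw [RingHom.id_apply, ← UniformSpace.Completion.coe_smul]
    exact congrArg _ (TensorProduct.smul_tmul' c f (1 : BddMeas X)).symm

/-- The same as an operator `L²(X, μ) ⊇ C → H`, given by its graph `{(f, f ⊗ 1) | f ∈ C}`. -/
def preDeriv : Lp ℝ 2 μ →ₗ.[ℝ] G.OneForms :=
  (LinearMap.range ((E.domain.subtype.comp E.contDomain.subtype).prod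
    G.derivCont)).toLinearPMap

/-- The exterior derivative `∂ : L²(X, μ) ⊇ Dom E → H`, the closure of `f ↦ f ⊗ 1` on `C`. -/
def deriv : Lp ℝ 2 μ →ₗ.[ℝ] G.OneForms := G.preDeriv.closure

/-- The co-differential `∂* : H ⊇ Dom ∂* → L²(X, μ)`, the adjoint of `∂`. -/
def coderiv : G.OneForms →ₗ.[ℝ] Lp ℝ 2 μ := G.deriv.adjoint

/-- The Laplacian on one-forms `- ∂ ∂*`, with domain `{η ∈ Dom ∂* | ∂* η ∈ Dom ∂}`. -/
def formLaplacian : G.OneForms →ₗ.[ℝ] G.OneForms := -(compPMap G.deriv G.coderiv)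

/-- The semigroup on one-forms generated by `- ∂ ∂*`. -/
def formHeat (t : ℝ) (η : G.OneForms) : G.OneForms := expSemigroup G.formLaplacian t η

/-- The semigroup domination `‖e^{- t ∂ ∂*} η‖_{H_x} ≤ C (P_t ‖η‖_{H_·})(x)` for almost every `x`,
for all one-forms `η` and all `0 ≤ t ≤ 1`. -/
def SemigroupDomination (C : ℝ) : Prop :=
  ∀ (η : G.OneForms) (t : ℝ), 0 ≤ t → t ≤ 1 →
    ∀ᵐ x ∂μ, G.fiberNorm (G.formHeat t η) x ≤ C * E.heat t (G.fiberNorm η) x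

/-- The weak Bakry-Émery estimate `√Γ(P_t f) ≤ C₁ e^{C₂ t} P_t √Γ(f)` almost everywhere, for all
`f ∈ Dom E` and all `t ≥ 0` (note that `P_t f` always lies in `Dom E`). -/
def WeakBakryEmery (C₁ C₂ : ℝ) : Prop :=
  ∀ (f : E.domain) (t : ℝ), 0 ≤ t → ∀ h : E.heat t f ∈ E.domain,
    ∀ᵐ x ∂μ, sqrtL2 (G.gamma ⟨E.heat t f, h⟩ ⟨E.heat t f, h⟩) x ≤
      C₁ * Real.exp (C₂ * t) * E.heat t (sqrtL2 (G.gamma f f)) x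

/-- The total variation
`Var f = sup {⟨f, ∂* η⟩ | η ∈ Dom ∂*, ‖η‖_{H_x} ≤ 1 for almost every x}`, in `[0, ∞]`
(`η = 0` is allowed, so that truncating the values at `0` does not change the supremum). -/
def variation (f : Lp ℝ 2 μ) : ℝ≥0∞ :=
  ⨆ (η : G.coderiv.domain) (_ : ∀ᵐ x ∂μ, G.fiberNorm (η : G.OneForms) x ≤ 1),
    ENNReal.ofReal (inner ℝ f (G.coderiv η))

/-- The space `BV(X)` of bounded Borel functions of finite variation. -/
def BV [IsFiniteMeasure μ] : Set (BddMeas X) :=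
  {f | G.variation (BddMeas.toL2 μ f) < ∞}

end CarreDuChamp

end DirichletSpace

end

/-! The estimate is proved by duality. Since `P_t` is symmetric, `‖P_t f - f‖₁ = ⟨f, P_t g - g⟩`
with `g` the sign of `P_t f - f`. For `g` in the domain of `Δ`, `d/ds ⟨f, P_s g⟩ = ⟨f, Δ P_s g⟩ =
-⟨f, ∂*∂ P_s g⟩`, and a multiple of `∂ P_s g` is a test form for the variation as soon as `√Γ(P_s
g)` is bounded. Everything therefore rests on the gradient bound `√Γ(P_s g) ≤ C₁ / √(2s)` for `|g| ≤
1` (`gradNorm_heat_le`): its integral over `0 ≤ s ≤ t` is `C₁ √(2t)`. This gives the constant `C₁`,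
and `C₁ ≤ C₁³`.

The gradient bound is a Bakry-Ledoux interpolation. For a bounded `h ≥ 0` put `φ(r) = ∫ P_r h
(P_{s-r} g)² dμ`. The carré du champ identity gives `φ'(r) = 2 ∫ P_r h Γ(P_{s-r} g) dμ`
(`two_mul_inner_gradNorm`). The Bakry-Émery estimate, followed by the Jensen inequality `(P_r F)² ≤
P_r (F²)` and symmetry, bounds this below by `2 C₁⁻² ∫ h Γ(P_s g) dμ` (`inner_gradNorm_heat_le`).
Hence `2s ∫ h Γ(P_s g) ≤ C₁² (φ(s) - φ(0)) ≤ C₁² ∫ h`, and `h` is arbitrary enough to make this a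
pointwise bound.

The groundwork turns the definitions into usable facts. The limit of Yosida exponentials is a
symmetric contraction semigroup, differentiable on the domain of its generator (`ResolventFamily`).
The form has a resolvent by Riesz representation (`resolventFamily`). Regularity, locality and
compactness put `1` in the form domain with zero energy, so resolvents and semigroup are Markov
(`isMarkov_resolvent`, `isMarkov_heatCLM`). Bounded elements of the form domain form an algebra
(`mulL2_mem_domain`), which the carré du champ identity needs. Finally `∂` is isometric for the
energy on `C`, hence closable, with `∂*∂ = -Δ` (`exists_coderiv_eq`). -/

noncomputable section

namespace DirichletSpace

/-! ### Hille-Yosida theory: the semigroup as a limit of Yosida exponentials -/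

section Semigroup

variable {H : Type*} [NormedAddCommGroup H] [InnerProductSpace ℝ H]

theorem IsResolvent.eq {A : H →ₗ.[ℝ] H} {l : ℝ} {R S : H →L[ℝ] H} (hR : IsResolvent A l R)
    (hS : IsResolvent A l S) : R = S := by
  ext y
  obtain ⟨x, hx, hy⟩ := hS.1 y
  rw [← hx, ← hR.2 x, hy]

theorem resolventOp_eq {A : H →ₗ.[ℝ] H} {l : ℝ} {R : H →L[ℝ] H} (hR : IsResolvent A l R) :
    resolventOp A l = R := by
  have h : ∃ R, IsResolvent A l R := ⟨R, hR⟩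
  rw [resolventOp, dif_pos h]
  exact h.choose_spec.eq hR

/-- The resolvent identity: apply `R` to `(l - A) S y = y + (l - m) S y`. -/
theorem IsResolvent.sub_apply {A : H →ₗ.[ℝ] H} {l m : ℝ} {R S : H →L[ℝ] H}
    (hR : IsResolvent A l R) (hS : IsResolvent A m S) (y : H) :
    R y - S y = (m - l) • R (S y) := by
  obtain ⟨x, hx, hy⟩ := hS.1 y
  have h1 := hR.2 x
  have h2 : l • (x : H) - A x = y + (l - m) • (x : H) := by rw [← hy]; module
  rw [h2, map_add, map_smul] at h1
  rw [← hx, eq_sub_of_add_eq h1]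
  module

theorem IsResolvent.commute {A : H →ₗ.[ℝ] H} {l m : ℝ} {R S : H →L[ℝ] H}
    (hR : IsResolvent A l R) (hS : IsResolvent A m S) : Commute R S := by
  rcases eq_or_ne l m with rfl | hlm
  · rw [hR.eq hS]
  · ext y
    have h1 := hR.sub_apply hS y
    have h2 := hS.sub_apply hR y
    have h3 : (m - l) • (R (S y) - S (R y)) = 0 := by
      rw [smul_sub, ← h1]
      have : (m - l) • S (R y) = - (S y - R y) := by rw [h2]; module
      rw [this]; abel
    rcases smul_eq_zero.1 h3 with h | h
    · exact absurd (sub_eq_zero.1 h).symm hlm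
    · exact sub_eq_zero.1 h

/-- A family of resolvents of a densely defined nonpositive self-adjoint operator. -/
structure ResolventFamily [CompleteSpace H] (A : H →ₗ.[ℝ] H) (R : ℝ → H →L[ℝ] H) : Prop where
  isResolvent : ∀ l, 0 < l → IsResolvent A l (R l)
  norm_le : ∀ l, 0 < l → ‖l • R l‖ ≤ 1
  isSelfAdjoint : ∀ l, 0 < l → IsSelfAdjoint (R l)
  tendsto : ∀ x, Tendsto (fun l => l • R l x) atTop (𝓝 x)

variable [CompleteSpace H]

/-- Yosida approximations have the form `l (T - 1)` with `T = l (l - A)⁻¹`. Splitting off `e^{-s}`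
leaves a power series in `T` with nonnegative coefficients, so contractivity and positivity pass
from `T` to the exponential. -/
theorem exp_smul_sub_one (s : ℝ) (T : H →L[ℝ] H) :
    NormedSpace.exp (s • (T - 1)) = Real.exp (-s) • NormedSpace.exp (s • T) := by
  let _ := NormedAlgebra.restrictScalars ℚ ℝ (H →L[ℝ] H)
  have h : s • (T - 1) = algebraMap ℝ (H →L[ℝ] H) (-s) + s • T := by
    rw [Algebra.algebraMap_eq_smul_one]; module
  rw [h, NormedSpace.exp_add_of_commute (Algebra.commutes _ _),
    ← NormedSpace.algebraMap_exp_comm, ← Real.exp_eq_exp_ℝ, ← Algebra.smul_def]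

theorem norm_exp_smul_sub_one_le {s : ℝ} (hs : 0 ≤ s) {T : H →L[ℝ] H} (hT : ‖T‖ ≤ 1) :
    ‖NormedSpace.exp (s • (T - 1))‖ ≤ 1 := by
  have h1 : ‖NormedSpace.exp (s • T)‖ ≤ Real.exp s := by
    have hs1 := NormedSpace.exp_series_hasSum_exp' (𝕂 := ℝ) (s • T)
    have hs2 := NormedSpace.exp_series_hasSum_exp' (𝕂 := ℝ) s
    rw [← Real.exp_eq_exp_ℝ] at hs2
    refine hs1.norm_le_of_bounded hs2 fun n => ?_
    rw [norm_smul, smul_pow, norm_smul, smul_eq_mul, Real.norm_of_nonneg (by positivity),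
      Real.norm_of_nonneg (by positivity)]
    gcongr
    refine mul_le_of_le_one_right (by positivity) ?_
    rcases Nat.eq_zero_or_pos n with rfl | hn
    · rw [pow_zero]; exact ContinuousLinearMap.norm_id_le
    · exact (norm_pow_le' T hn).trans (pow_le_one₀ (norm_nonneg _) hT)
  rw [exp_smul_sub_one, norm_smul, Real.norm_of_nonneg (Real.exp_pos _).le]
  calc _ ≤ Real.exp (-s) * Real.exp s := by gcongr
    _ = 1 := by rw [← Real.exp_add, neg_add_cancel, Real.exp_zero]

namespace ResolventFamily

variable {A : H →ₗ.[ℝ] H} {R : ℝ → H →L[ℝ] H} (hR : ResolventFamily A R)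
include hR

theorem yosida_eq {l : ℝ} (hl : 0 < l) : yosida A l = l • (l • R l - 1) := by
  rw [yosida, resolventOp_eq (hR.isResolvent l hl)]

theorem norm_exp_le {l : ℝ} (hl : 0 < l) {t : ℝ} (ht : 0 ≤ t) :
    ‖NormedSpace.exp (t • yosida A l)‖ ≤ 1 := by
  rw [hR.yosida_eq hl, smul_smul]
  exact norm_exp_smul_sub_one_le (by positivity) (hR.norm_le l hl)

theorem norm_exp_apply_le {l : ℝ} (hl : 0 < l) {t : ℝ} (ht : 0 ≤ t) (x : H) :
    ‖NormedSpace.exp (t • yosida A l) x‖ ≤ ‖x‖ := by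
  simpa using ContinuousLinearMap.le_of_opNorm_le _ (hR.norm_exp_le hl ht) x

theorem commute_yosida_resolvent {l m : ℝ} (hl : 0 < l) (hm : 0 < m) :
    Commute (yosida A l) (R m) := by
  rw [hR.yosida_eq hl]
  exact ((((hR.isResolvent l hl).commute (hR.isResolvent m hm)).smul_left l).sub_left
    (Commute.one_left _)).smul_left l

theorem commute_yosida {l m : ℝ} (hl : 0 < l) (hm : 0 < m) :
    Commute (yosida A l) (yosida A m) := by
  rw [hR.yosida_eq hm]
  exact (((hR.commute_yosida_resolvent hl hm).smul_right m).sub_right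
    (Commute.one_right _)).smul_right m

/-- The two exponentials are the endpoints of the path `s ↦ e^{tC} e^{s(B - C)} x` on `[0, t]`,
whose speed is at most `‖B x - C x‖`. -/
theorem norm_exp_sub_exp_le {l m : ℝ} (hl : 0 < l) (hm : 0 < m) {t : ℝ} (ht : 0 ≤ t) (x : H) :
    ‖NormedSpace.exp (t • yosida A l) x - NormedSpace.exp (t • yosida A m) x‖ ≤
      ‖yosida A l x - yosida A m x‖ * t := by
  let _ := NormedAlgebra.restrictScalars ℚ ℝ (H →L[ℝ] H)
  set B := yosida A l
  set C := yosida A m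
  have hc : Commute B C := hR.commute_yosida hl hm
  have hD : ∀ s : ℝ, HasDerivAt
      (fun s : ℝ => NormedSpace.exp (t • C) (NormedSpace.exp (s • (B - C)) x))
      (NormedSpace.exp (t • C) ((NormedSpace.exp (s • (B - C)) * (B - C)) x)) s := fun s =>
    (NormedSpace.exp (t • C)).hasFDerivAt.comp_hasDerivAt s
      ((hasDerivAt_exp_smul_const (𝕂 := ℝ) (B - C) s).clm_apply (hasDerivAt_const s x) |>.congr_deriv
        (by simp))
  have hb : ∀ s ∈ Set.Ico 0 t,
      ‖NormedSpace.exp (t • C) ((NormedSpace.exp (s • (B - C)) * (B - C)) x)‖ ≤ ‖B x - C x‖ := by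
    intro s hs
    -- `B - C` need not generate contractions; regrouping as `e^{(t-s)C} e^{sB}` leaves two
    -- exponentials at nonnegative times.
    have e : NormedSpace.exp (t • C) * NormedSpace.exp (s • (B - C)) =
        NormedSpace.exp ((t - s) • C) * NormedSpace.exp (s • B) := by
      rw [← NormedSpace.exp_add_of_commute, ← NormedSpace.exp_add_of_commute]
      · congr 1; module
      · exact (hc.symm.smul_left _).smul_right _
      · exact ((hc.symm.sub_right (Commute.refl C)).smul_left _).smul_right _
    have e2 : NormedSpace.exp (t • C) ((NormedSpace.exp (s • (B - C)) * (B - C)) x) =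
        (NormedSpace.exp (t • C) * NormedSpace.exp (s • (B - C))) (B x - C x) := rfl
    rw [e2, e]
    exact (hR.norm_exp_apply_le hm (by linarith [hs.2]) _).trans
      (hR.norm_exp_apply_le hl hs.1 _)
  have h := norm_image_sub_le_of_norm_deriv_le_segment' (fun s _ => (hD s).hasDerivWithinAt) hb t
    (Set.right_mem_Icc.2 ht)
  have e3 : NormedSpace.exp (t • C) (NormedSpace.exp (t • (B - C)) x) =
      NormedSpace.exp (t • B) x := by
    rw [← mul_apply_eq_comp, ← NormedSpace.exp_add_of_commute]
    · congr 2; module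
    · exact ((hc.symm.sub_right (Commute.refl C)).smul_left _).smul_right _
  simpa [e3] using h

/-- On the domain `A_l x = l (l - A)⁻¹ A x`, and `l (l - A)⁻¹` tends strongly to the identity. -/
theorem tendsto_yosida (x : A.domain) :
    Tendsto (fun l => yosida A l x) atTop (𝓝 (A x)) := by
  refine (hR.tendsto (A x)).congr' ?_
  filter_upwards [eventually_gt_atTop 0] with l hl
  have h := (hR.isResolvent l hl).2 x
  rw [map_sub, map_smul] at h
  rw [hR.yosida_eq hl]
  simp only [smul_apply, sub_apply, one_apply_eq_self]
  congr 1
  nth_rewrite 2 [← h]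
  abel

theorem dense_domain : Dense (A.domain : Set H) := fun x => by
  refine mem_closure_of_tendsto (hR.tendsto x) ?_
  filter_upwards [eventually_gt_atTop 0] with l hl
  obtain ⟨y, hy, -⟩ := (hR.isResolvent l hl).1 x
  rw [← hy]
  exact A.domain.smul_mem l y.2

/-- On the domain this is `norm_exp_sub_exp_le` with `tendsto_yosida`; contractivity extends it to
all `x` by density. Uniformity in `t` is what later gives continuity and differentiability of the
semigroup. -/
theorem uniformCauchySeqOn_exp (b : ℝ) (x : H) :
    UniformCauchySeqOn (fun (l : ℝ) (t : ℝ) => NormedSpace.exp (t • yosida A l) x) atTop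
      (Set.Icc 0 b) := by
  rcases lt_or_ge b 0 with hb | hb
  · rw [Set.Icc_eq_empty (not_le.2 hb)]
    intro u hu; simp
  rw [Metric.uniformCauchySeqOn_iff]
  intro ε hε
  obtain ⟨y, hy, hxy⟩ := Metric.mem_closure_iff.1 (hR.dense_domain x) (ε / 3) (by positivity)
  obtain ⟨N, hN⟩ := Metric.cauchySeq_iff.1 (hR.tendsto_yosida ⟨y, hy⟩).cauchySeq
    (ε / 3 / (b + 1)) (by positivity)
  refine ⟨max N 1, fun l hl m hm t ht => ?_⟩
  have hl0 : 0 < l := lt_of_lt_of_le one_pos ((le_max_right _ _).trans hl)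
  have hm0 : 0 < m := lt_of_lt_of_le one_pos ((le_max_right _ _).trans hm)
  have h1 := hR.norm_exp_sub_exp_le hl0 hm0 ht.1 y
  have h2 := hN l ((le_max_left _ _).trans hl) m ((le_max_left _ _).trans hm)
  rw [dist_eq_norm] at h2 hxy ⊢
  have h3 : ‖yosida A l y - yosida A m y‖ * t < ε / 3 := by
    calc _ ≤ ‖yosida A l y - yosida A m y‖ * (b + 1) := by gcongr; linarith [ht.2]
      _ < ε / 3 / (b + 1) * (b + 1) := by gcongr
      _ = ε / 3 := by field_simp
  have h4 := hR.norm_exp_apply_le hl0 ht.1 (x - y)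
  have h5 := hR.norm_exp_apply_le hm0 ht.1 (x - y)
  have e : NormedSpace.exp (t • yosida A l) x - NormedSpace.exp (t • yosida A m) x =
      NormedSpace.exp (t • yosida A l) (x - y) +
      (NormedSpace.exp (t • yosida A l) y - NormedSpace.exp (t • yosida A m) y) -
      NormedSpace.exp (t • yosida A m) (x - y) := by
    rw [map_sub, map_sub]; abel
  rw [e]
  calc _ ≤ _ := norm_sub_le _ _
    _ ≤ _ := add_le_add_left (norm_add_le _ _) _
    _ < ε := by linarith

theorem tendsto_exp {t : ℝ} (ht : 0 ≤ t) (x : H) :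
    Tendsto (fun l : ℝ => NormedSpace.exp (t • yosida A l) x) atTop
      (𝓝 (expSemigroup A t x)) :=
  ((hR.uniformCauchySeqOn_exp t x).cauchy_map ⟨ht, le_rfl⟩).le_nhds_lim

theorem tendstoUniformlyOn_exp (b : ℝ) (x : H) :
    TendstoUniformlyOn (fun (l : ℝ) (t : ℝ) => NormedSpace.exp (t • yosida A l) x)
      (fun t => expSemigroup A t x) atTop (Set.Icc 0 b) :=
  (hR.uniformCauchySeqOn_exp b x).tendstoUniformlyOn_of_tendsto fun _ ht => hR.tendsto_exp ht.1 x

theorem norm_expSemigroup_le {t : ℝ} (ht : 0 ≤ t) (x : H) : ‖expSemigroup A t x‖ ≤ ‖x‖ := by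
  refine le_of_tendsto (hR.tendsto_exp ht x).norm ?_
  filter_upwards [eventually_gt_atTop 0] with l hl
  exact hR.norm_exp_apply_le hl ht x

theorem expSemigroup_add {t : ℝ} (ht : 0 ≤ t) (x y : H) :
    expSemigroup A t (x + y) = expSemigroup A t x + expSemigroup A t y := by
  refine tendsto_nhds_unique (hR.tendsto_exp ht _) ?_
  simpa only [map_add] using (hR.tendsto_exp ht x).add (hR.tendsto_exp ht y)

theorem expSemigroup_smul {t : ℝ} (ht : 0 ≤ t) (c : ℝ) (x : H) :
    expSemigroup A t (c • x) = c • expSemigroup A t x := by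
  refine tendsto_nhds_unique (hR.tendsto_exp ht _) ?_
  simpa only [map_smul] using (hR.tendsto_exp ht x).const_smul c

open scoped Classical in
omit hR in
/-- The semigroup `e^{tA}` as a family of bounded operators (with value `0` for `t < 0`). -/
def semigroup (hR : ResolventFamily A R) (t : ℝ) : H →L[ℝ] H :=
  if ht : 0 ≤ t then
    LinearMap.mkContinuous
      { toFun := expSemigroup A t
        map_add' := hR.expSemigroup_add ht
        map_smul' := hR.expSemigroup_smul ht } 1
      fun x => by simpa using hR.norm_expSemigroup_le ht x
  else 0

theorem semigroup_apply {t : ℝ} (ht : 0 ≤ t) (x : H) :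
    hR.semigroup t x = expSemigroup A t x := by
  rw [semigroup, dif_pos ht]; rfl

theorem tendsto_semigroup {t : ℝ} (ht : 0 ≤ t) (x : H) :
    Tendsto (fun l : ℝ => NormedSpace.exp (t • yosida A l) x) atTop
      (𝓝 (hR.semigroup t x)) := by
  rw [hR.semigroup_apply ht]; exact hR.tendsto_exp ht x

theorem semigroup_zero (x : H) : hR.semigroup 0 x = x := by
  refine tendsto_nhds_unique (hR.tendsto_semigroup le_rfl x) ?_
  simp

theorem inner_semigroup {t : ℝ} (ht : 0 ≤ t) (x y : H) :
    inner ℝ (hR.semigroup t x) y = inner ℝ x (hR.semigroup t y) := by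
  refine tendsto_nhds_unique ((hR.tendsto_semigroup ht x).inner tendsto_const_nhds)
    ((tendsto_const_nhds.inner (hR.tendsto_semigroup ht y)).congr' ?_)
  filter_upwards [eventually_gt_atTop 0] with l hl
  have h : IsSelfAdjoint (NormedSpace.exp (t • yosida A l)) := by
    rw [hR.yosida_eq hl]
    refine IsSelfAdjoint.exp ?_
    exact IsSelfAdjoint.smul (.all _) (IsSelfAdjoint.smul (.all _)
      ((IsSelfAdjoint.smul (.all _) (hR.isSelfAdjoint l hl)).sub (.one _)))
  exact ((ContinuousLinearMap.isSelfAdjoint_iff_isSymmetric.1 h) x y).symm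

theorem semigroup_add {s t : ℝ} (hs : 0 ≤ s) (ht : 0 ≤ t) (x : H) :
    hR.semigroup (s + t) x = hR.semigroup s (hR.semigroup t x) := by
  let _ := NormedAlgebra.restrictScalars ℚ ℝ (H →L[ℝ] H)
  refine tendsto_nhds_unique (hR.tendsto_semigroup (add_nonneg hs ht) x) ?_
  have h1 : Tendsto (fun l : ℝ => NormedSpace.exp (s • yosida A l)
      (NormedSpace.exp (t • yosida A l) x - hR.semigroup t x)) atTop (𝓝 0) := by
    refine squeeze_zero_norm' ?_ (tendsto_iff_norm_sub_tendsto_zero.1 (hR.tendsto_semigroup ht x))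
    filter_upwards [eventually_gt_atTop 0] with l hl
    exact hR.norm_exp_apply_le hl hs _
  have h2 := h1.add (hR.tendsto_semigroup hs (hR.semigroup t x))
  rw [zero_add] at h2
  refine h2.congr fun l => ?_
  rw [map_sub, sub_add_cancel, add_smul, NormedSpace.exp_add_of_commute]
  · rfl
  · exact ((Commute.refl _).smul_left _).smul_right _

theorem continuousOn_semigroup (x : H) :
    ContinuousOn (fun t => hR.semigroup t x) (Set.Ici 0) := by
  let _ := NormedAlgebra.restrictScalars ℚ ℝ (H →L[ℝ] H)
  intro t ht
  have h : ContinuousOn (fun t => expSemigroup A t x) (Set.Icc 0 (t + 1)) :=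
    (hR.tendstoUniformlyOn_exp (t + 1) x).continuousOn <| Frequently.of_forall fun l =>
      ((NormedSpace.exp_continuous.comp (by fun_prop : Continuous fun t : ℝ => t • yosida A l)
        ).clm_apply continuous_const).continuousOn
  have h1 : ContinuousWithinAt (fun t => hR.semigroup t x) (Set.Icc 0 (t + 1)) t :=
    (h.congr fun s hs => hR.semigroup_apply hs.1 x) t ⟨ht, by linarith⟩
  refine h1.mono_of_mem_nhdsWithin ?_
  rw [← Set.Ici_inter_Iic]
  exact inter_mem_nhdsWithin _ (Iic_mem_nhds (by linarith))

theorem semigroup_resolvent {t : ℝ} (ht : 0 ≤ t) {m : ℝ} (hm : 0 < m) (x : H) :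
    hR.semigroup t (R m x) = R m (hR.semigroup t x) := by
  let _ := NormedAlgebra.restrictScalars ℚ ℝ (H →L[ℝ] H)
  refine tendsto_nhds_unique (hR.tendsto_semigroup ht (R m x))
    ((((R m).continuous.tendsto _).comp (hR.tendsto_semigroup ht x)).congr' ?_)
  filter_upwards [eventually_gt_atTop 0] with l hl
  have h := ((hR.commute_yosida_resolvent hl hm).smul_left t).exp_left
  exact (DFunLike.congr_fun h.eq x).symm

/-- The semigroup commutes with `(1 - A)⁻¹`, and `x = (1 - A)⁻¹ (x - A x)`, so its image is again in
the range of the resolvent. -/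
theorem semigroup_mem_domain {t : ℝ} (ht : 0 ≤ t) (x : A.domain) :
    ∃ h : hR.semigroup t x ∈ A.domain, A ⟨hR.semigroup t x, h⟩ = hR.semigroup t (A x) := by
  have h1 := (hR.isResolvent 1 one_pos).2 x
  rw [one_smul] at h1
  obtain ⟨y, hy, hy2⟩ := (hR.isResolvent 1 one_pos).1 (hR.semigroup t (x - A x))
  rw [← hR.semigroup_resolvent ht one_pos, h1] at hy
  refine ⟨hy ▸ y.2, ?_⟩
  have : (⟨hR.semigroup t x, hy ▸ y.2⟩ : A.domain) = y := Subtype.ext hy.symm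
  rw [this]
  rw [one_smul, hy, map_sub] at hy2
  simpa using hy2

/-- The derivatives `e^{s A_l} A_l x` converge uniformly near `t`: replace `A_l x` by `A x` using
contractivity, then use the uniform convergence of `e^{s A_l} A x`. -/
theorem hasDerivAt_semigroup {t : ℝ} (ht : 0 < t) (x : A.domain) :
    HasDerivAt (fun s => hR.semigroup s x) (hR.semigroup t (A x)) t := by
  have hs : IsOpen (Set.Ioo 0 (t + 1)) := isOpen_Ioo
  have hmem : t ∈ Set.Ioo 0 (t + 1) := ⟨ht, by linarith⟩
  refine hasDerivAt_of_tendstoUniformlyOn (l := atTop) (g' := fun s => hR.semigroup s (A x))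
    (f := fun (l : ℝ) (s : ℝ) => NormedSpace.exp (s • yosida A l) x)
    (f' := fun l s => NormedSpace.exp (s • yosida A l) (yosida A l x)) hs ?_ ?_ ?_ hmem
  · rw [Metric.tendstoUniformlyOn_iff]
    intro ε hε
    filter_upwards [eventually_gt_atTop 0,
      Metric.tendstoUniformlyOn_iff.1 (hR.tendstoUniformlyOn_exp (t + 1) (A x)) (ε / 2)
        (by positivity), (Metric.tendsto_nhds.1 (hR.tendsto_yosida x)) (ε / 2) (by positivity)]
      with l hl h1 h2 s hs
    have h3 := h1 s ⟨hs.1.le, hs.2.le⟩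
    have h4 := hR.norm_exp_apply_le hl hs.1.le (yosida A l x - A x)
    rw [map_sub, ← dist_eq_norm, ← dist_eq_norm] at h4
    rw [hR.semigroup_apply hs.1.le]
    calc _ ≤ _ := dist_triangle _ (NormedSpace.exp (s • yosida A l) (A x)) _
      _ < ε := by rw [dist_comm (NormedSpace.exp (s • yosida A l) (A x))]; linarith
  · refine Eventually.of_forall fun l s _ => ?_
    exact ((hasDerivAt_exp_smul_const (𝕂 := ℝ) (yosida A l) s).clm_apply
      (hasDerivAt_const s (x : H))).congr_deriv (by simp)
  · intro s hs
    exact hR.tendsto_semigroup hs.1.le x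

end ResolventFamily

end Semigroup

end DirichletSpace
end

/-! ### The resolvent of a Dirichlet form and its approximating energies -/

noncomputable section

namespace DirichletSpace

namespace DirichletForm

variable {X : Type*} [MeasurableSpace X] {μ : Measure X} (E : DirichletForm μ)

/-- The form domain, to be equipped with the scalar product `l ⟨u, v⟩ + E(u, v)`. -/
def FormSpace (E : DirichletForm μ) (_l : ℝ) : Type _ := E.domain

instance (l : ℝ) : AddCommGroup (FormSpace E l) := inferInstanceAs (AddCommGroup E.domain)
instance (l : ℝ) : Module ℝ (FormSpace E l) := inferInstanceAs (Module ℝ E.domain)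

/-- The element of the form space defined by an element of the form domain. -/
def toFormSpace (l : ℝ) (u : E.domain) : FormSpace E l := u

/-- The element of the form domain underlying an element of the form space. -/
def ofFormSpace {l : ℝ} (u : FormSpace E l) : E.domain := u

theorem form_sub_self (u v : E.domain) :
    E.form (u - v) (u - v) = E.form u u - 2 * E.form u v + E.form v v := by
  simp only [map_sub, LinearMap.sub_apply, E.symm v u]
  ring

/-- The scalar product `l ⟨u, v⟩ + E(u, v)`. -/
@[reducible]
def formCore (l : ℝ) [hl : Fact (0 < l)] : InnerProductSpace.Core ℝ (FormSpace E l) where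
  inner u v := l * inner ℝ (E.ofFormSpace u : Lp ℝ 2 μ) (E.ofFormSpace v) +
    E.form (E.ofFormSpace u) (E.ofFormSpace v)
  conj_inner_symm u v := by
    rw [E.symm, real_inner_comm]; rfl
  re_inner_nonneg u := add_nonneg (mul_nonneg hl.out.le real_inner_self_nonneg) (E.nonneg _)
  add_left u v w := by
    have h : E.ofFormSpace (u + v) = E.ofFormSpace u + E.ofFormSpace v := rfl
    rw [h, map_add, LinearMap.add_apply, Submodule.coe_add, inner_add_left]
    ring
  smul_left u v r := by
    have h : E.ofFormSpace (r • u) = r • E.ofFormSpace u := rfl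
    rw [h, map_smul, LinearMap.smul_apply, Submodule.coe_smul, real_inner_smul_left, smul_eq_mul]
    simp only [conj_trivial]
    ring
  definite u hu := by
    have h1 := E.nonneg (E.ofFormSpace u)
    have h2 : (0 : ℝ) ≤ inner ℝ (E.ofFormSpace u : Lp ℝ 2 μ) (E.ofFormSpace u) :=
      real_inner_self_nonneg
    have h3 : inner ℝ (E.ofFormSpace u : Lp ℝ 2 μ) (E.ofFormSpace u) = 0 := by
      have := hl.out
      have h4 := mul_nonneg this.le h2
      have h5 : l * inner ℝ (E.ofFormSpace u : Lp ℝ 2 μ) (E.ofFormSpace u) = 0 := by linarith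
      exact (mul_eq_zero.1 h5).resolve_left this.ne'
    exact Subtype.ext (inner_self_eq_zero.1 h3)

instance (l : ℝ) [Fact (0 < l)] : NormedAddCommGroup (FormSpace E l) :=
  (E.formCore l).toNormedAddCommGroup

instance (l : ℝ) [Fact (0 < l)] : InnerProductSpace ℝ (FormSpace E l) :=
  .ofCore (E.formCore l).toCore

theorem inner_formSpace {l : ℝ} [Fact (0 < l)] (u v : FormSpace E l) :
    inner ℝ u v = l * inner ℝ (E.ofFormSpace u : Lp ℝ 2 μ) (E.ofFormSpace v) +
    E.form (E.ofFormSpace u) (E.ofFormSpace v) := rfl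

theorem norm_sq_formSpace {l : ℝ} [Fact (0 < l)] (u : FormSpace E l) :
    ‖u‖ ^ 2 = l * ‖(E.ofFormSpace u : Lp ℝ 2 μ)‖ ^ 2 +
    E.form (E.ofFormSpace u) (E.ofFormSpace u) := by
  rw [← real_inner_self_eq_norm_sq, inner_formSpace, real_inner_self_eq_norm_sq]

instance (l : ℝ) [hl : Fact (0 < l)] : CompleteSpace (FormSpace E l) := by
  have hl := hl.out
  refine Metric.complete_of_cauchySeq_tendsto fun u hu => ?_
  obtain ⟨v, hv⟩ := E.closed (fun n => E.ofFormSpace (u n)) fun ε hε => by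
    -- The norm squared lies between `min 1 l` and `max 1 l` times the `E₁`-energy, so closedness of
    -- the form gives completeness for every `l > 0`.
    obtain ⟨N, hN⟩ := Metric.cauchySeq_iff.1 hu (Real.sqrt (min 1 l * ε)) (by positivity)
    refine ⟨N, fun m hm n hn => ?_⟩
    have h := hN m hm n hn
    rw [dist_eq_norm, Real.lt_sqrt (norm_nonneg _), norm_sq_formSpace] at h
    change l * ‖(E.ofFormSpace (u m) : Lp ℝ 2 μ) - E.ofFormSpace (u n)‖ ^ 2 +
      E.form (E.ofFormSpace (u m) - E.ofFormSpace (u n))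
        (E.ofFormSpace (u m) - E.ofFormSpace (u n)) < _ at h
    have h1 := E.nonneg (E.ofFormSpace (u m) - E.ofFormSpace (u n))
    have h2 := sq_nonneg ‖(E.ofFormSpace (u m) : Lp ℝ 2 μ) - E.ofFormSpace (u n)‖
    set a := ‖(E.ofFormSpace (u m) : Lp ℝ 2 μ) - E.ofFormSpace (u n)‖ ^ 2
    set b := E.form (E.ofFormSpace (u m) - E.ofFormSpace (u n))
        (E.ofFormSpace (u m) - E.ofFormSpace (u n))
    have h3 : min 1 l * (a + b) ≤ l * a + b := by
      rw [mul_add]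
      exact add_le_add (mul_le_mul_of_nonneg_right (min_le_right _ _) h2)
        (mul_le_of_le_one_left h1 (min_le_left _ _))
    exact lt_of_mul_lt_mul_left (h3.trans_lt h) (by positivity)
  refine ⟨E.toFormSpace l v, ?_⟩
  rw [tendsto_iff_norm_sub_tendsto_zero]
  have h : Tendsto (fun n => ‖u n - E.toFormSpace l v‖ ^ 2) atTop (𝓝 0) := by
    refine squeeze_zero (fun _ => sq_nonneg _) (fun n => ?_) (mul_zero (max 1 l) ▸ hv.const_mul (max 1 l))
    rw [norm_sq_formSpace]
    refine le_of_le_of_eq (add_le_add ?_ ?_) (mul_add _ _ _).symm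
    · exact mul_le_mul_of_nonneg_right (le_max_right _ _) (sq_nonneg _)
    · exact le_mul_of_one_le_left (E.nonneg _) (le_max_left _ _)
  have h2 := h.sqrt
  simpa [Real.sqrt_sq (norm_nonneg _)] using h2

/-- The embedding of the form domain into `L²`. -/
def formEmbedding (l : ℝ) [hl : Fact (0 < l)] : FormSpace E l →L[ℝ] Lp ℝ 2 μ :=
  LinearMap.mkContinuous E.domain.subtype (Real.sqrt l)⁻¹ fun u => by
    have hl := hl.out
    rw [inv_mul_eq_div, le_div_iff₀ (Real.sqrt_pos.2 hl)]
    refine abs_le_of_sq_le_sq' ?_ (norm_nonneg _) |>.2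
    rw [mul_pow, Real.sq_sqrt hl.le, norm_sq_formSpace, mul_comm]
    exact le_add_of_nonneg_right (E.nonneg _)

theorem formEmbedding_apply {l : ℝ} [Fact (0 < l)] (u : FormSpace E l) :
    E.formEmbedding l u = (E.ofFormSpace u : Lp ℝ 2 μ) := rfl

open scoped Classical in
/-- The resolvent `(l - Δ)⁻¹` of the form, by the Riesz representation theorem. -/
def resolvent (l : ℝ) : Lp ℝ 2 μ →L[ℝ] Lp ℝ 2 μ :=
  if h : 0 < l then
    haveI : Fact (0 < l) := ⟨h⟩
    (E.formEmbedding l).comp (E.formEmbedding l).adjoint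
  else 0

variable {l : ℝ}

theorem resolvent_mem (hl : 0 < l) (f : Lp ℝ 2 μ) : E.resolvent l f ∈ E.domain := by
  rw [resolvent, dif_pos hl]
  have : Fact (0 < l) := ⟨hl⟩
  exact (E.ofFormSpace ((E.formEmbedding l).adjoint f)).2

/-- The resolvent `(l - Δ)⁻¹ f` as an element of the form domain. -/
def resolventDom (hl : 0 < l) (f : Lp ℝ 2 μ) : E.domain := ⟨E.resolvent l f, E.resolvent_mem hl f⟩

@[simp] theorem coe_resolventDom (hl : 0 < l) (f : Lp ℝ 2 μ) :
    (E.resolventDom hl f : Lp ℝ 2 μ) = E.resolvent l f := rfl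

/-- The weak equation `(l - Δ) R f = f`: with `J` the embedding into `L²`, `J* f` is the Riesz
representative of `φ ↦ ⟨f, φ⟩` for `l ⟨·,·⟩ + E`. -/
theorem form_resolvent (hl : 0 < l) (f : Lp ℝ 2 μ) (φ : E.domain) :
    E.form (E.resolventDom hl f) φ = inner ℝ (f - l • E.resolvent l f) (φ : Lp ℝ 2 μ) := by
  have : Fact (0 < l) := ⟨hl⟩
  have h1 : E.resolventDom hl f = E.ofFormSpace ((E.formEmbedding l).adjoint f) := by
    refine Subtype.ext ?_
    rw [coe_resolventDom, resolvent, dif_pos hl]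
    rfl
  have h2 := ContinuousLinearMap.adjoint_inner_left (E.formEmbedding l) (E.toFormSpace l φ) f
  rw [inner_formSpace, ← h1, formEmbedding_apply] at h2
  change l * inner ℝ (E.resolvent l f) (φ : Lp ℝ 2 μ) + E.form (E.resolventDom hl f) φ =
    inner ℝ f (φ : Lp ℝ 2 μ) at h2
  rw [inner_sub_left, real_inner_smul_left, ← h2]
  ring

theorem generatorGraph_functional (p : Lp ℝ 2 μ × Lp ℝ 2 μ) (hp : p ∈ E.generatorGraph)
    (h0 : p.1 = 0) : p.2 = 0 := by
  obtain ⟨h, hp⟩ := hp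
  have h1 : (⟨p.1, h⟩ : E.domain) = 0 := Subtype.ext h0
  refine E.dense.eq_zero_of_inner_left ℝ fun φ hφ => ?_
  have := hp ⟨φ, hφ⟩
  rw [h1, map_zero, LinearMap.zero_apply] at this
  linarith

theorem generator_graph : E.generator.graph = E.generatorGraph :=
  Submodule.toLinearPMap_graph_eq _ E.generatorGraph_functional

theorem generator_domain_le {x : Lp ℝ 2 μ} (hx : x ∈ E.generator.domain) : x ∈ E.domain := by
  have h := E.generator.mem_graph ⟨x, hx⟩
  rw [generator_graph] at h
  exact h.1

theorem form_generator (x : E.generator.domain) (φ : E.domain) :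
    E.form ⟨x, E.generator_domain_le x.2⟩ φ = - inner ℝ (E.generator x) (φ : Lp ℝ 2 μ) := by
  have h := E.generator.mem_graph x
  rw [generator_graph] at h
  exact h.2 φ

theorem exists_generator_eq {p : Lp ℝ 2 μ × Lp ℝ 2 μ} (hp : p ∈ E.generatorGraph) :
    ∃ x : E.generator.domain, (x : Lp ℝ 2 μ) = p.1 ∧ E.generator x = p.2 := by
  rw [← generator_graph] at hp
  exact E.generator.mem_graph_iff.1 hp

theorem eq_zero_of_form_eq (hl : 0 < l) (u : E.domain)
    (h : ∀ φ : E.domain, E.form u φ = - l * inner ℝ (u : Lp ℝ 2 μ) (φ : Lp ℝ 2 μ)) : u = 0 := by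
  have h1 := h u
  have h2 := E.nonneg u
  rw [real_inner_self_eq_norm_sq] at h1
  have h3 : ‖(u : Lp ℝ 2 μ)‖ ^ 2 ≤ 0 := by
    by_contra! h4
    nlinarith [mul_pos hl h4]
  exact Subtype.ext (norm_eq_zero.1 (pow_eq_zero_iff two_ne_zero |>.1 (le_antisymm h3 (sq_nonneg _))))

theorem eq_resolvent (hl : 0 < l) (u : E.domain) (f : Lp ℝ 2 μ)
    (h : ∀ φ : E.domain, E.form u φ = inner ℝ (f - l • (u : Lp ℝ 2 μ)) (φ : Lp ℝ 2 μ)) :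
    (u : Lp ℝ 2 μ) = E.resolvent l f := by
  have h0 : u - E.resolventDom hl f = 0 := E.eq_zero_of_form_eq hl _ fun φ => by
    rw [map_sub, LinearMap.sub_apply, h, form_resolvent, ← inner_sub_left, Submodule.coe_sub,
      coe_resolventDom, ← real_inner_smul_left]
    congr 1
    module
  rw [sub_eq_zero.1 h0]; rfl

theorem isResolvent_resolvent (hl : 0 < l) : IsResolvent E.generator l (E.resolvent l) := by
  constructor
  · intro y
    obtain ⟨x, hx, hx2⟩ := E.exists_generator_eq
      (p := (E.resolvent l y, l • E.resolvent l y - y)) ⟨E.resolvent_mem hl y, fun φ => by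
        have := E.form_resolvent hl y φ
        rw [← inner_neg_left, neg_sub]
        exact this⟩
    refine ⟨x, hx, ?_⟩
    rw [hx, hx2, sub_sub_cancel]
  · intro x
    refine (E.eq_resolvent hl ⟨x, E.generator_domain_le x.2⟩ _ fun φ => ?_).symm
    rw [form_generator, ← inner_neg_left]
    congr 1
    abel

/-- The approximating energy `l ⟨u - l (l - Δ)⁻¹ u, u⟩`. -/
def approxEnergy (l : ℝ) (u : Lp ℝ 2 μ) : ℝ := l * inner ℝ (u - l • E.resolvent l u) u

theorem form_smul_resolvent (hl : 0 < l) (f : Lp ℝ 2 μ) (φ : E.domain) :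
    E.form (l • E.resolventDom hl f) φ = l * inner ℝ (f - l • E.resolvent l f) (φ : Lp ℝ 2 μ) := by
  rw [map_smul, LinearMap.smul_apply, form_resolvent, smul_eq_mul]

theorem approxEnergy_eq (hl : 0 < l) (u : Lp ℝ 2 μ) :
    E.approxEnergy l u = E.form (l • E.resolventDom hl u) (l • E.resolventDom hl u) +
      l * ‖u - l • E.resolvent l u‖ ^ 2 := by
  rw [form_smul_resolvent, approxEnergy, ← real_inner_self_eq_norm_sq, ← mul_add,
    ← inner_add_right]
  congr 2
  rw [Submodule.coe_smul, coe_resolventDom]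
  abel

theorem mul_norm_sub_sq_le (hl : 0 < l) (u : Lp ℝ 2 μ) :
    l * ‖u - l • E.resolvent l u‖ ^ 2 ≤ E.approxEnergy l u := by
  rw [E.approxEnergy_eq hl]
  exact le_add_of_nonneg_left (E.nonneg _)

/-- Expand `E(u - l R_l u) ≥ 0`: the cross term is the approximating energy, which by
`approxEnergy_eq` also dominates `E(l R_l u)`. -/
theorem approxEnergy_le (hl : 0 < l) (u : E.domain) : E.approxEnergy l u ≤ E.form u u := by
  have h1 := E.form_smul_resolvent hl u u
  have h2 := E.approxEnergy_eq hl u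
  have h3 := E.nonneg (u - l • E.resolventDom hl u)
  have h4 : 0 ≤ l * ‖(u : Lp ℝ 2 μ) - l • E.resolvent l u‖ ^ 2 := by positivity
  have h5 := E.symm u (l • E.resolventDom hl u)
  rw [form_sub_self, h5] at h3
  rw [approxEnergy] at h2 ⊢
  linarith

/-- This makes the approximating energy monotone in `l`; once it is bounded, `l R_l u` is therefore
Cauchy for the energy. -/
theorem form_sub_resolvent_le {l m : ℝ} (hl : 0 < l) (hm : 0 < m) (hml : m ≤ l) (u : Lp ℝ 2 μ) :
    E.form (l • E.resolventDom hl u - m • E.resolventDom hm u)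
      (l • E.resolventDom hl u - m • E.resolventDom hm u) ≤
      E.approxEnergy l u - E.approxEnergy m u := by
  have h1 := E.form_smul_resolvent hm u (l • E.resolventDom hl u)
  have h2 := E.approxEnergy_eq hl u
  have h3 := E.approxEnergy_eq hm u
  have h5 := E.symm (l • E.resolventDom hl u) (m • E.resolventDom hm u)
  rw [form_sub_self, h5, h1]
  have e : ((l • E.resolventDom hl u : E.domain) : Lp ℝ 2 μ) =
      u - (u - l • E.resolvent l u) := by simp
  rw [e, inner_sub_right, mul_sub]
  have h6 : E.approxEnergy m u = m * inner ℝ (u - m • E.resolvent m u) u := rfl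
  rw [← h6]
  set p := u - l • E.resolvent l u
  set q := u - m • E.resolvent m u
  have h7 : (0 : ℝ) ≤ ‖q - p‖ ^ 2 := sq_nonneg _
  rw [norm_sub_sq_real] at h7
  have h8 : m * ‖p‖ ^ 2 ≤ l * ‖p‖ ^ 2 := by gcongr
  nlinarith [mul_nonneg hm.le h7]

theorem norm_smul_resolvent_le (hl : 0 < l) (u : Lp ℝ 2 μ) : ‖l • E.resolvent l u‖ ≤ ‖u‖ := by
  have h1 := E.form_smul_resolvent hl u (l • E.resolventDom hl u)
  have h2 := E.nonneg (l • E.resolventDom hl u)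
  rw [h1, Submodule.coe_smul, coe_resolventDom] at h2
  have h3 := nonneg_of_mul_nonneg_right h2 hl
  rw [inner_sub_left, real_inner_self_eq_norm_sq] at h3
  have h4 := real_inner_le_norm u (l • E.resolvent l u)
  by_contra! h5
  nlinarith [norm_nonneg u, norm_nonneg (l • E.resolvent l u)]

theorem tendsto_of_approxEnergy_le {K : ℝ} {u : Lp ℝ 2 μ}
    (h : ∀ l, 0 < l → E.approxEnergy l u ≤ K) :
    Tendsto (fun l => l • E.resolvent l u) atTop (𝓝 u) := by
  rw [tendsto_iff_norm_sub_tendsto_zero]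
  have h0 : Tendsto (fun l => Real.sqrt (K / l)) atTop (𝓝 0) := by
    simpa using (tendsto_const_nhds.div_atTop tendsto_id : Tendsto (fun l : ℝ => K / l) _ _).sqrt
  refine squeeze_zero' (Eventually.of_forall fun _ => norm_nonneg _) ?_ h0
  filter_upwards [eventually_gt_atTop 0] with l hl
  rw [norm_sub_rev]
  refine Real.le_sqrt_of_sq_le ?_
  rw [le_div_iff₀ hl, mul_comm]
  exact (E.mul_norm_sub_sq_le hl u).trans (h l hl)

theorem tendsto_smul_resolvent (u : Lp ℝ 2 μ) :
    Tendsto (fun l => l • E.resolvent l u) atTop (𝓝 u) := by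
  rw [Metric.tendsto_nhds]
  intro ε hε
  obtain ⟨v, hv, huv⟩ := Metric.mem_closure_iff.1 (E.dense u) (ε / 3) (by positivity)
  filter_upwards [eventually_gt_atTop 0, Metric.tendsto_nhds.1 (E.tendsto_of_approxEnergy_le
    fun l hl => E.approxEnergy_le hl ⟨v, hv⟩) (ε / 3) (by positivity)] with l hl h
  have h1 := E.norm_smul_resolvent_le hl (u - v)
  rw [map_sub, smul_sub, ← dist_eq_norm, ← dist_eq_norm] at h1
  calc _ ≤ _ := dist_triangle4 _ (l • E.resolvent l v) v u
    _ < ε := by rw [dist_comm v u]; linarith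

/-- The way into the form domain: bounded monotone energies make `(n + 1) R_{n+1} u` an `E₁`-Cauchy
sequence, which converges to `u` in `L²`, and the form is closed. -/
theorem mem_domain_of_approxEnergy_le {K : ℝ} {u : Lp ℝ 2 μ}
    (h : ∀ l, 0 < l → E.approxEnergy l u ≤ K) : u ∈ E.domain := by
  have hn : ∀ n : ℕ, (0 : ℝ) < n + 1 := fun n => by positivity
  set v : ℕ → E.domain := fun n => ((n : ℝ) + 1) • E.resolventDom (hn n) u
  set e : ℕ → ℝ := fun n => E.approxEnergy (n + 1) u
  have hle : ∀ m n, m ≤ n → E.form (v n - v m) (v n - v m) ≤ e n - e m := fun m n hmn =>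
    E.form_sub_resolvent_le (hn n) (hn m) (by gcongr) u
  have hmono : Monotone e := fun m n hmn => by
    have := (E.nonneg _).trans (hle m n hmn)
    linarith
  have he : CauchySeq e := (tendsto_atTop_ciSup hmono
    ⟨K, by rintro _ ⟨n, rfl⟩; exact h _ (hn n)⟩).cauchySeq
  have hv : Tendsto (fun n => (v n : Lp ℝ 2 μ)) atTop (𝓝 u) :=
    (E.tendsto_smul_resolvent u).comp
      (tendsto_atTop_add_const_right _ (1 : ℝ) tendsto_natCast_atTop_atTop)
  obtain ⟨w, hw⟩ := E.closed v fun ε hε => by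
    obtain ⟨N₁, hN₁⟩ := Metric.cauchySeq_iff.1 he (ε / 2) (by positivity)
    obtain ⟨N₂, hN₂⟩ := Metric.cauchySeq_iff.1 hv.cauchySeq (Real.sqrt (ε / 2)) (by positivity)
    refine ⟨max N₁ N₂, fun m hm n hn => ?_⟩
    have h1 := hN₁ m ((le_max_left _ _).trans hm) n ((le_max_left _ _).trans hn)
    have h2 := hN₂ m ((le_max_right _ _).trans hm) n ((le_max_right _ _).trans hn)
    rw [dist_eq_norm, Real.lt_sqrt (norm_nonneg _)] at h2
    have h3 : E.form (v m - v n) (v m - v n) ≤ |e m - e n| := by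
      rcases le_total m n with hmn | hmn
      · have e1 : v m - v n = -(v n - v m) := by abel
        rw [e1, map_neg, map_neg, LinearMap.neg_apply, neg_neg, abs_sub_comm]
        exact (hle m n hmn).trans (le_abs_self _)
      · exact (hle n m hmn).trans (le_abs_self _)
    rw [Real.dist_eq] at h1
    linarith
  have h1 : Tendsto (fun n => (v n : Lp ℝ 2 μ)) atTop (𝓝 (w : Lp ℝ 2 μ)) := by
    rw [tendsto_iff_norm_sub_tendsto_zero]
    have h2 : Tendsto (fun n => ‖(v n : Lp ℝ 2 μ) - w‖ ^ 2) atTop (𝓝 0) :=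
      squeeze_zero (fun _ => sq_nonneg _)
        (fun n => le_add_of_nonneg_right (E.nonneg (v n - w))) hw
    have h3 := h2.sqrt
    simpa [Real.sqrt_sq (norm_nonneg _)] using h3
  rw [tendsto_nhds_unique hv h1]
  exact w.2

theorem resolventFamily : ResolventFamily E.generator E.resolvent where
  isResolvent _ hl := E.isResolvent_resolvent hl
  norm_le l hl := ContinuousLinearMap.opNorm_le_bound _ zero_le_one fun x => by
    simpa using E.norm_smul_resolvent_le hl x
  isSelfAdjoint l hl := by
    rw [resolvent, dif_pos hl]
    have : Fact (0 < l) := ⟨hl⟩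
    -- The resolvent is `J J*`, which is its own adjoint.
    have := ContinuousLinearMap.adjoint_comp (E.formEmbedding l) (E.formEmbedding l).adjoint
    rw [ContinuousLinearMap.adjoint_adjoint] at this
    exact this
  tendsto := E.tendsto_smul_resolvent

/-- The heat semigroup as a family of bounded operators. -/
def heatCLM (t : ℝ) : Lp ℝ 2 μ →L[ℝ] Lp ℝ 2 μ := E.resolventFamily.semigroup t

theorem heat_eq {t : ℝ} (ht : 0 ≤ t) (f : Lp ℝ 2 μ) : E.heat t f = E.heatCLM t f :=
  (E.resolventFamily.semigroup_apply ht f).symm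

end DirichletForm

end DirichletSpace
end

/-! ### Markov operators on `L²` and the algebra of bounded functions in the form domain -/

noncomputable section

namespace DirichletSpace

open DirichletForm

section L2

variable {X : Type*} [MeasurableSpace X] {μ : Measure X}

theorem inner_eq_integral_mul (u v : Lp ℝ 2 μ) : inner ℝ u v = ∫ x, u x * v x ∂μ := by
  rw [L2.inner_def]
  exact integral_congr_ae (Eventually.of_forall fun x => mul_comm _ _)

theorem integrable_mul (u v : Lp ℝ 2 μ) : Integrable (fun x => u x * v x) μ :=
  (L2.integrable_inner (𝕜 := ℝ) v u)

theorem inner_nonneg {u v : Lp ℝ 2 μ} (hu : 0 ≤ u) (hv : 0 ≤ v) : 0 ≤ inner ℝ u v := by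
  rw [inner_eq_integral_mul]
  refine integral_nonneg_of_ae ?_
  filter_upwards [(Lp.coeFn_nonneg u).2 hu, (Lp.coeFn_nonneg v).2 hv] with x h1 h2
  exact mul_nonneg h1 h2

theorem smul_nonneg_L2 {c : ℝ} (hc : 0 ≤ c) {u : Lp ℝ 2 μ} (hu : 0 ≤ u) : 0 ≤ c • u := by
  rw [← Lp.coeFn_nonneg] at hu ⊢
  filter_upwards [hu, Lp.coeFn_smul c u] with x h1 h2
  rw [h2]
  exact mul_nonneg hc h1

/-- Nonnegative simple functions are bounded and dense in the nonnegative cone. -/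
theorem nonneg_induction {P : Lp ℝ 2 μ → Prop} (hP : IsClosed {f | P f})
    (h : ∀ f, 0 ≤ f → EssBounded f → P f) {f : Lp ℝ 2 μ} (hf : 0 ≤ f) : P f := by
  have hd := Lp.simpleFunc.denseRange_coeSimpleFuncNonnegToLpNonneg 2 μ ℝ (by simp)
  refine hd.induction_on (p := fun g => P g.1) ⟨f, hf⟩ (hP.preimage continuous_subtype_val) ?_
  intro g
  refine h _ g.2 ?_
  obtain ⟨C, hC⟩ := (Lp.simpleFunc.toSimpleFunc g.1).exists_forall_norm_le
  refine ⟨C, ?_⟩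
  filter_upwards [Lp.simpleFunc.toSimpleFunc_eq_toFun g.1] with x hx
  have := hC x
  rwa [hx] at this

theorem DirichletForm.EssBounded.memLp_mul {u : Lp ℝ 2 μ} (hu : EssBounded u) (v : Lp ℝ 2 μ) :
    MemLp (fun x => u x * v x) 2 μ :=
  (Lp.memLp v).of_le_mul (c := hu.choose)
    ((Lp.aestronglyMeasurable u).mul (Lp.aestronglyMeasurable v))
    (hu.choose_spec.mono fun x hx => by rw [norm_mul]; gcongr; exact hx)

/-- Multiplication by an essentially bounded element of `L²` (and `0` if it is unbounded). -/
def mulL2 (u : Lp ℝ 2 μ) : Lp ℝ 2 μ →L[ℝ] Lp ℝ 2 μ :=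
  open scoped Classical in
  if h : EssBounded u then
    LinearMap.mkContinuous
      { toFun := fun v => (h.memLp_mul v).toLp _
        map_add' := fun v w => by
          rw [← MemLp.toLp_add]
          refine MemLp.toLp_congr _ _ ?_
          filter_upwards [Lp.coeFn_add v w] with x hx
          rw [hx, Pi.add_apply, Pi.add_apply, mul_add]
        map_smul' := fun c v => by
          rw [RingHom.id_apply, ← MemLp.toLp_const_smul]
          refine MemLp.toLp_congr _ _ ?_
          filter_upwards [Lp.coeFn_smul c v] with x hx
          rw [hx, Pi.smul_apply, Pi.smul_apply, smul_eq_mul, smul_eq_mul]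
          ring } h.choose
      fun v => Lp.norm_le_mul_norm_of_ae_le_mul (by
        filter_upwards [MemLp.coeFn_toLp (h.memLp_mul v), h.choose_spec] with x h1 h2
        change ‖(h.memLp_mul v).toLp _ x‖ ≤ _
        rw [h1, norm_mul]
        gcongr
        exact h2)
  else 0

theorem coeFn_mulL2 {u : Lp ℝ 2 μ} (hu : EssBounded u) (v : Lp ℝ 2 μ) :
    mulL2 u v =ᵐ[μ] fun x => u x * v x := by
  rw [mulL2, dif_pos hu]
  exact MemLp.coeFn_toLp (hu.memLp_mul v)

theorem inner_mulL2 {u : Lp ℝ 2 μ} (hu : EssBounded u) (v w : Lp ℝ 2 μ) :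
    inner ℝ (mulL2 u v) w = inner ℝ v (mulL2 u w) := by
  rw [inner_eq_integral_mul, inner_eq_integral_mul]
  refine integral_congr_ae ?_
  filter_upwards [coeFn_mulL2 hu v, coeFn_mulL2 hu w] with x h1 h2
  rw [h1, h2]
  ring

theorem mulL2_comm {u v : Lp ℝ 2 μ} (hu : EssBounded u) (hv : EssBounded v) :
    mulL2 u v = mulL2 v u := by
  refine Lp.ext ?_
  filter_upwards [coeFn_mulL2 hu v, coeFn_mulL2 hv u] with x h1 h2
  rw [h1, h2, mul_comm]

theorem DirichletForm.EssBounded.add {u v : Lp ℝ 2 μ} (hu : EssBounded u)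
    (hv : EssBounded v) : EssBounded (u + v) := by
  obtain ⟨C, hC⟩ := hu
  obtain ⟨D, hD⟩ := hv
  refine ⟨C + D, ?_⟩
  filter_upwards [hC, hD, Lp.coeFn_add u v] with x h1 h2 h3
  rw [h3]
  exact (abs_add_le _ _).trans (add_le_add h1 h2)

theorem DirichletForm.EssBounded.mulL2 {u v : Lp ℝ 2 μ} (hu : EssBounded u)
    (hv : EssBounded v) : EssBounded (mulL2 u v) := by
  obtain ⟨C, hC⟩ := id hu
  obtain ⟨D, hD⟩ := hv
  refine ⟨C * D, ?_⟩
  filter_upwards [hC, hD, coeFn_mulL2 hu v] with x h1 h2 h3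
  rw [h3, abs_mul]
  exact mul_le_mul h1 h2 (abs_nonneg _) ((abs_nonneg _).trans h1)

theorem norm_mulL2_le {u : Lp ℝ 2 μ} {M : ℝ} (hu : ∀ᵐ x ∂μ, |u x| ≤ M) (v : Lp ℝ 2 μ) :
    ‖mulL2 u v‖ ≤ M * ‖v‖ := by
  refine Lp.norm_le_mul_norm_of_ae_le_mul ?_
  filter_upwards [hu, coeFn_mulL2 ⟨M, hu⟩ v] with x h1 h2
  rw [h2, norm_mul]
  gcongr
  exact h1

variable [IsFiniteMeasure μ]

variable (μ) in
/-- The constant function `1` in `L²`. -/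
def oneL2 : Lp ℝ 2 μ := Lp.const 2 μ 1

theorem coeFn_oneL2 : oneL2 μ =ᵐ[μ] fun _ => 1 := Lp.coeFn_const 2 μ 1

theorem essBounded_oneL2 : EssBounded (oneL2 μ) :=
  ⟨1, by filter_upwards [coeFn_oneL2 (μ := μ)] with x hx; rw [hx, abs_one]⟩

theorem mulL2_oneL2 {u : Lp ℝ 2 μ} (hu : EssBounded u) : mulL2 u (oneL2 μ) = u := by
  refine Lp.ext ?_
  filter_upwards [coeFn_mulL2 hu (oneL2 μ), coeFn_oneL2 (μ := μ)] with x h1 h2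
  rw [h1, h2, mul_one]

theorem le_smul_oneL2_iff {u : Lp ℝ 2 μ} {c : ℝ} : u ≤ c • oneL2 μ ↔ ∀ᵐ x ∂μ, u x ≤ c := by
  rw [← Lp.coeFn_le]
  refine eventually_congr ?_
  filter_upwards [Lp.coeFn_smul c (oneL2 μ), coeFn_oneL2 (μ := μ)] with x h1 h2
  rw [h1, Pi.smul_apply, h2, smul_eq_mul, mul_one]

theorem smul_oneL2_le_iff {u : Lp ℝ 2 μ} {c : ℝ} : c • oneL2 μ ≤ u ↔ ∀ᵐ x ∂μ, c ≤ u x := by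
  rw [← Lp.coeFn_le]
  refine eventually_congr ?_
  filter_upwards [Lp.coeFn_smul c (oneL2 μ), coeFn_oneL2 (μ := μ)] with x h1 h2
  rw [h1, Pi.smul_apply, h2, smul_eq_mul, mul_one]

/-- A symmetric, positivity preserving operator which fixes the constants. -/
structure IsMarkov (T : Lp ℝ 2 μ →L[ℝ] Lp ℝ 2 μ) : Prop where
  nonneg : ∀ f, 0 ≤ f → 0 ≤ T f
  map_one : T (oneL2 μ) = oneL2 μ
  symm : ∀ f g, inner ℝ (T f) g = inner ℝ f (T g)

namespace IsMarkov

variable {T : Lp ℝ 2 μ →L[ℝ] Lp ℝ 2 μ} (hT : IsMarkov T)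
include hT

theorem mono {f g : Lp ℝ 2 μ} (h : f ≤ g) : T f ≤ T g := by
  have := hT.nonneg (g - f) (sub_nonneg.2 h)
  rwa [map_sub, sub_nonneg] at this

theorem map_smul_one (c : ℝ) : T (c • oneL2 μ) = c • oneL2 μ := by
  rw [map_smul, hT.map_one]

theorem le_of_le {f : Lp ℝ 2 μ} {c : ℝ} (h : ∀ᵐ x ∂μ, f x ≤ c) : ∀ᵐ x ∂μ, T f x ≤ c := by
  rw [← le_smul_oneL2_iff] at h ⊢
  rw [← hT.map_smul_one]
  exact hT.mono h

theorem ge_of_ge {f : Lp ℝ 2 μ} {c : ℝ} (h : ∀ᵐ x ∂μ, c ≤ f x) : ∀ᵐ x ∂μ, c ≤ T f x := by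
  rw [← smul_oneL2_le_iff] at h ⊢
  rw [← hT.map_smul_one]
  exact hT.mono h

theorem abs_le {f : Lp ℝ 2 μ} {c : ℝ} (h : ∀ᵐ x ∂μ, |f x| ≤ c) : ∀ᵐ x ∂μ, |T f x| ≤ c := by
  filter_upwards [hT.le_of_le (h.mono fun x hx => (_root_.abs_le.1 hx).2),
    hT.ge_of_ge (h.mono fun x hx => (_root_.abs_le.1 hx).1)] with x h1 h2
  exact _root_.abs_le.2 ⟨h2, h1⟩

theorem essBounded {f : Lp ℝ 2 μ} (h : EssBounded f) : EssBounded (T f) := by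
  obtain ⟨C, hC⟩ := h
  exact ⟨C, hT.abs_le hC⟩

theorem inner_one (f : Lp ℝ 2 μ) : inner ℝ (oneL2 μ) (T f) = inner ℝ (oneL2 μ) f := by
  rw [← hT.symm, hT.map_one]

/-- A pointwise inequality which is linear in elements of `L²`, with coefficients depending
continuously on a parameter, is preserved by a Markov operator for almost every point and all
parameters simultaneously. -/
theorem forall_nonneg {k : ℕ} (c : Fin k → ℝ → ℝ) (hc : ∀ i, Continuous (c i))
    (v : Fin k → Lp ℝ 2 μ) (h : ∀ a, ∀ᵐ x ∂μ, 0 ≤ ∑ i, c i a * v i x) :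
    ∀ᵐ x ∂μ, ∀ a, 0 ≤ ∑ i, c i a * T (v i) x := by
  have key : ∀ (w : Fin k → Lp ℝ 2 μ) (a : ℝ),
      ((∑ i, c i a • w i : Lp ℝ 2 μ) : X → ℝ) =ᵐ[μ] fun x => ∑ i, c i a * w i x := by
    intro w a
    have h1 : ∀ᵐ x ∂μ, ∀ i, (c i a • w i : Lp ℝ 2 μ) x = c i a * w i x :=
      ae_all_iff.2 fun i => Lp.coeFn_smul _ _
    filter_upwards [h1, Lp.coeFn_finsetSum Finset.univ fun i => c i a • w i] with x hx hx2
    rw [hx2, Finset.sum_apply]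
    exact Finset.sum_congr rfl fun i _ => hx i
  -- Rational parameters share one null set; continuity of the coefficients does the rest. This
  -- makes it legitimate to substitute `a = u x` afterwards, without a kernel for `T`.
  have hq : ∀ᵐ x ∂μ, ∀ q : ℚ, 0 ≤ ∑ i, c i q * T (v i) x := by
    rw [ae_all_iff]
    intro q
    have h1 : 0 ≤ ∑ i, c i q • v i := by
      rw [← Lp.coeFn_nonneg]
      filter_upwards [key v q, h q] with x h1 h2
      rw [h1]
      exact h2
    have h2 := hT.nonneg _ h1
    rw [map_sum] at h2
    simp only [map_smul] at h2
    rw [← Lp.coeFn_nonneg] at h2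
    filter_upwards [key (fun i => T (v i)) q, h2] with x h3 h4
    rw [← h3]
    exact h4
  filter_upwards [hq] with x hx a
  refine Rat.denseRange_cast.induction_on (p := fun a => 0 ≤ ∑ i, c i a * T (v i) x) a
    (isClosed_le continuous_const ?_) hx
  exact continuous_finsetSum _ fun i _ => (hc i).mul continuous_const

/-- With a kernel for `T` this would be the integral of `(a² - y²)² ≤ 4 M² (a - y)²` for `|a|, |y| ≤
M`. Instead, `T` acts on the polynomial in `y = u` with `a` as parameter, then `a = u x` is
substituted and the result integrated; `∫ T w = ∫ w` turns the sum into the two inner products. -/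
theorem inner_sq_sub_le {u : Lp ℝ 2 μ} {M : ℝ} (hu : ∀ᵐ x ∂μ, |u x| ≤ M) :
    inner ℝ (mulL2 u u - T (mulL2 u u)) (mulL2 u u) ≤ 4 * M ^ 2 * inner ℝ (u - T u) u := by
  have hb : EssBounded u := ⟨M, hu⟩
  set w := mulL2 u u
  have hw := coeFn_mulL2 hb u
  have hwb : EssBounded w := hb.mulL2 hb
  have hz := coeFn_mulL2 hwb w
  set z := mulL2 w w
  -- `forall_nonneg` wants the inequality for every real `a`, but it holds only for `|a| ≤ M`; the
  -- clamp repairs this and does nothing at `a = u x`.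
  let b : ℝ → ℝ := fun a => max (-M) (min M a)
  have hbc : Continuous b := by fun_prop
  have hM : ∀ᵐ x ∂μ, 0 ≤ M := hu.mono fun x hx => (abs_nonneg _).trans hx
  have h1 := hT.forall_nonneg
    ![fun a => 4 * M ^ 2 * b a ^ 2 - b a ^ 4, fun a => -(8 * M ^ 2 * b a),
      fun a => 4 * M ^ 2 + 2 * b a ^ 2, fun _ => -1] (by
        intro i
        fin_cases i <;> simp <;> fun_prop) ![oneL2 μ, u, w, z] (by
        intro a
        filter_upwards [hu, coeFn_oneL2 (μ := μ), hw, hz, hM] with x hx h1 hw hz hM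
        simp only [Fin.sum_univ_four, Matrix.cons_val]
        rw [h1, hz, hw]
        have hb1 : b a ≤ M := max_le (by linarith) (min_le_left _ _)
        have hb2 : -M ≤ b a := le_max_left _ _
        obtain ⟨hx1, hx2⟩ := _root_.abs_le.1 hx
        have h2 : (b a + u x) ^ 2 ≤ (2 * M) ^ 2 := sq_le_sq' (by linarith) (by linarith)
        nlinarith [mul_nonneg (sq_nonneg (b a - u x)) (sub_nonneg.2 h2)])
  have h2 : ∀ᵐ x ∂μ, 0 ≤ (4 * M ^ 2 * (u x * u x) - 8 * M ^ 2 * (u x * T u x) +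
      4 * M ^ 2 * (oneL2 μ x * T w x)) +
      (2 * (w x * T w x) - w x * w x - oneL2 μ x * T z x) := by
    filter_upwards [h1, hu, coeFn_oneL2 (μ := μ), hw] with x h hx h1 hw
    have := h (u x)
    simp only [Fin.sum_univ_four, Matrix.cons_val] at this
    obtain ⟨hx1, hx2⟩ := _root_.abs_le.1 hx
    have hbu : b (u x) = u x := by
      simp only [b]
      rw [min_eq_right hx2, max_eq_right hx1]
    rw [hbu, hT.map_one, h1] at this
    rw [h1, hw]
    linarith
  have h3 := integral_nonneg_of_ae h2
  have i1 := (integrable_mul u u).const_mul (4 * M ^ 2)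
  have i2 := (integrable_mul u (T u)).const_mul (8 * M ^ 2)
  have i3 := (integrable_mul (oneL2 μ) (T w)).const_mul (4 * M ^ 2)
  have i4 := (integrable_mul w (T w)).const_mul 2
  have i5 := integrable_mul w w
  have i6 := integrable_mul (oneL2 μ) (T z)
  have e0 : ∀ {F₁ F₂ F₃ F₄ F₅ F₆ : X → ℝ}, Integrable F₁ μ → Integrable F₂ μ →
      Integrable F₃ μ → Integrable F₄ μ → Integrable F₅ μ → Integrable F₆ μ →
      ∫ x, (F₁ x - F₂ x + F₃ x) + (F₄ x - F₅ x - F₆ x) ∂μ =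
        (∫ x, F₁ x ∂μ - ∫ x, F₂ x ∂μ + ∫ x, F₃ x ∂μ) +
          (∫ x, F₄ x ∂μ - ∫ x, F₅ x ∂μ - ∫ x, F₆ x ∂μ) := by
    intro F₁ F₂ F₃ F₄ F₅ F₆ j1 j2 j3 j4 j5 j6
    rw [← integral_sub j1 j2, ← integral_sub j4 j5]
    exact (integral_add ((j1.sub j2).add j3) ((j4.sub j5).sub j6)).trans
      (congrArg₂ _ (integral_add (j1.sub j2) j3) (integral_sub (j4.sub j5) j6))
  rw [e0 i1 i2 i3 i4 i5 i6, integral_const_mul, integral_const_mul, integral_const_mul,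
    integral_const_mul] at h3
  simp only [← inner_eq_integral_mul] at h3
  have e1 : inner ℝ (oneL2 μ) (T w) = inner ℝ u u := by
    rw [hT.inner_one, ← inner_mulL2 hb, mulL2_oneL2 hb]
  have e2 : inner ℝ (oneL2 μ) (T z) = inner ℝ w w := by
    rw [hT.inner_one, ← inner_mulL2 hwb, mulL2_oneL2 hwb]
  rw [e1, e2] at h3
  rw [inner_sub_left, inner_sub_left, hT.symm, hT.symm]
  linarith

/-- Jensen's inequality `(T F)² ≤ T (F²)`, integrated against `h`, with `T` moved onto `h` by
symmetry. It comes from applying `T` to `(a - F)² ≥ 0` and taking `a = T F x`. Bounded `F` come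
first so that `F²` is in `L²`. -/
theorem inner_mul_apply_sq_le {h F : Lp ℝ 2 μ} (hh : EssBounded h) (h0 : 0 ≤ h) (hF : 0 ≤ F) :
    inner ℝ (mulL2 h (T F)) (T F) ≤ inner ℝ (mulL2 (T h) F) F := by
  refine nonneg_induction (P := fun F => inner ℝ (mulL2 h (T F)) (T F) ≤
    inner ℝ (mulL2 (T h) F) F) (isClosed_le (by fun_prop) (by fun_prop)) ?_ hF
  intro F hF hb
  have hw := coeFn_mulL2 hb F
  set w := mulL2 F F
  have h1 := hT.forall_nonneg ![fun a => a ^ 2, fun a => -(2 * a), fun _ => 1] (by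
        intro i
        fin_cases i <;> simp <;> fun_prop) ![oneL2 μ, F, w] (by
        intro a
        filter_upwards [coeFn_oneL2 (μ := μ), hw] with x h1 hw
        simp only [Fin.sum_univ_three, Matrix.cons_val]
        rw [h1, hw]
        nlinarith [sq_nonneg (a - F x)])
  have e : inner ℝ (mulL2 (T h) F) F = inner ℝ h (T w) := by
    rw [← hT.symm, inner_mulL2 (hT.essBounded hh), real_inner_comm, inner_eq_integral_mul,
      inner_eq_integral_mul]
    refine integral_congr_ae ?_
    filter_upwards [coeFn_mulL2 (hT.essBounded hh) F, hw] with x h1 h2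
    rw [h1, h2]
    ring
  rw [e, inner_eq_integral_mul, inner_eq_integral_mul]
  refine integral_mono_ae (integrable_mul _ _) (integrable_mul _ _) ?_
  filter_upwards [h1, coeFn_mulL2 hh (T F), (Lp.coeFn_nonneg h).2 h0, coeFn_oneL2 (μ := μ)]
    with x h1 h2 h3 h4
  have h5 := h1 (T F x)
  simp only [Fin.sum_univ_three, Matrix.cons_val] at h5
  rw [hT.map_one, h4] at h5
  rw [h2, mul_assoc]
  exact mul_le_mul_of_nonneg_left (by linarith) h3

end IsMarkov

theorem isMarkov_exp {T : Lp ℝ 2 μ →L[ℝ] Lp ℝ 2 μ} (hT : IsMarkov T) {s : ℝ} (hs : 0 ≤ s) :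
    (∀ f, 0 ≤ f → 0 ≤ NormedSpace.exp (s • (T - 1)) f) ∧
      NormedSpace.exp (s • (T - 1)) (oneL2 μ) = oneL2 μ := by
  have hsum : ∀ (B : Lp ℝ 2 μ →L[ℝ] Lp ℝ 2 μ) (f : Lp ℝ 2 μ),
      HasSum (fun n : ℕ => ((n.factorial : ℝ)⁻¹ • (B ^ n)) f) (NormedSpace.exp B f) := fun B f =>
    (NormedSpace.exp_series_hasSum_exp' (𝕂 := ℝ) B).mapL
      (ContinuousLinearMap.apply ℝ (Lp ℝ 2 μ) f)
  constructor
  · intro f hf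
    rw [exp_smul_sub_one]
    refine smul_nonneg_L2 (Real.exp_pos _).le ((hsum (s • T) f).nonneg fun n => ?_)
    refine smul_nonneg_L2 (by positivity) ?_
    induction n with
    | zero => exact hf
    | succ n ih =>
      rw [pow_succ']
      exact smul_nonneg_L2 hs (hT.nonneg _ ih)
  · have h0 : (s • (T - 1)) (oneL2 μ) = 0 := by
      rw [smul_apply, sub_apply, hT.map_one, one_apply_eq_self, sub_self, smul_zero]
    refine (hsum _ (oneL2 μ)).unique ?_
    have h := hasSum_single (f := fun n : ℕ => ((n.factorial : ℝ)⁻¹ • ((s • (T - 1)) ^ n))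
      (oneL2 μ)) 0 fun n hn => by
        obtain ⟨m, rfl⟩ := Nat.exists_eq_succ_of_ne_zero hn
        rw [Nat.succ_eq_add_one, pow_succ, smul_apply, mul_apply_eq_comp, h0, map_zero, smul_zero]
    simpa using h

end L2

namespace DirichletForm

variable {X : Type*} [MeasurableSpace X] {μ : Measure X} (E : DirichletForm μ)

/-- `w = l R_l f` is the unique minimiser of `E(v, v) + l ‖v - f‖²`. Truncating `w` to `[0, 1]`
increases neither term, as `f` already takes values there, so `w` equals its truncation. -/
theorem resolvent_mem_unit {l : ℝ} (hl : 0 < l) {f : Lp ℝ 2 μ}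
    (hf : ∀ᵐ x ∂μ, 0 ≤ f x ∧ f x ≤ 1) :
    ∀ᵐ x ∂μ, 0 ≤ (l • E.resolvent l f : Lp ℝ 2 μ) x := by
  set w : E.domain := l • E.resolventDom hl f
  obtain ⟨v, hv, hvE⟩ := E.markov w
  have h1 : ‖(v : Lp ℝ 2 μ) - f‖ ≤ ‖(w : Lp ℝ 2 μ) - f‖ := by
    refine Lp.norm_le_norm_of_ae_le ?_
    filter_upwards [hv, hf, Lp.coeFn_sub (v : Lp ℝ 2 μ) f, Lp.coeFn_sub (w : Lp ℝ 2 μ) f]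
      with x h1 ⟨h2, h3⟩ h4 h5
    rw [h4, h5, Pi.sub_apply, Pi.sub_apply, h1, Real.norm_eq_abs, Real.norm_eq_abs]
    have e : f x = min (max (f x) 0) 1 := by rw [max_eq_left h2, min_eq_left h3]
    nth_rewrite 1 [e]
    exact (abs_inf_sub_inf_le_abs _ _ _).trans (abs_max_sub_max_le_abs _ _ _)
  have h2 := E.form_sub_self v w
  have h3 := E.form_smul_resolvent hl f v
  have h4 := E.form_smul_resolvent hl f w
  rw [E.symm v w] at h2
  change E.form w v = l * inner ℝ (f - (w : Lp ℝ 2 μ)) (v : Lp ℝ 2 μ) at h3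
  change E.form w w = l * inner ℝ (f - (w : Lp ℝ 2 μ)) (w : Lp ℝ 2 μ) at h4
  have h5 : ‖(v : Lp ℝ 2 μ) - f‖ ^ 2 = ‖(v : Lp ℝ 2 μ) - w‖ ^ 2 -
      2 * (inner ℝ (f - (w : Lp ℝ 2 μ)) (v : Lp ℝ 2 μ) -
        inner ℝ (f - (w : Lp ℝ 2 μ)) (w : Lp ℝ 2 μ)) + ‖(w : Lp ℝ 2 μ) - f‖ ^ 2 := by
    have e : (v : Lp ℝ 2 μ) - f = (v - w) - (f - w) := by abel
    rw [e, norm_sub_sq_real, ← inner_sub_right, real_inner_comm, norm_sub_rev f]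
  have h6 : ‖(v : Lp ℝ 2 μ) - f‖ ^ 2 ≤ ‖(w : Lp ℝ 2 μ) - f‖ ^ 2 := by gcongr
  have h7 := E.nonneg (v - w)
  have h8 : ‖(v : Lp ℝ 2 μ) - w‖ ^ 2 ≤ 0 := by
    have h9 : l * ‖(v : Lp ℝ 2 μ) - w‖ ^ 2 ≤ l * (2 * (inner ℝ (f - (w : Lp ℝ 2 μ))
      (v : Lp ℝ 2 μ) - inner ℝ (f - (w : Lp ℝ 2 μ)) (w : Lp ℝ 2 μ))) := by gcongr; linarith
    by_contra! h10
    nlinarith [mul_pos hl h10]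
  have h9 : (v : Lp ℝ 2 μ) = w :=
    sub_eq_zero.1 (norm_eq_zero.1 (pow_eq_zero_iff two_ne_zero |>.1
      (le_antisymm h8 (sq_nonneg _))))
  have h10 : (l • E.resolvent l f : Lp ℝ 2 μ) = v := h9.symm
  rw [h10]
  filter_upwards [hv] with x hx
  rw [hx]
  exact le_min (le_max_right _ _) zero_le_one

theorem smul_resolvent_nonneg {l : ℝ} (hl : 0 < l) {f : Lp ℝ 2 μ} (hf : 0 ≤ f) :
    0 ≤ l • E.resolvent l f := by
  refine nonneg_induction (P := fun f => 0 ≤ l • E.resolvent l f)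
    (isClosed_le continuous_const (by fun_prop)) ?_ hf
  rintro f hf ⟨C, hC⟩
  have hC0 : 0 < |C| + 1 := by positivity
  have h1 := E.resolvent_mem_unit hl (f := (|C| + 1)⁻¹ • f) (by
    filter_upwards [hC, (Lp.coeFn_nonneg f).2 hf, Lp.coeFn_smul (|C| + 1)⁻¹ f] with x h1 h2 h3
    rw [h3, Pi.smul_apply, smul_eq_mul]
    refine ⟨mul_nonneg (by positivity) h2, ?_⟩
    rw [inv_mul_le_iff₀ hC0, mul_one]
    linarith [le_abs_self (f x), le_abs_self C])
  have h2 := smul_nonneg_L2 hC0.le ((Lp.coeFn_nonneg _).1 h1)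
  rwa [map_smul, smul_comm l, smul_inv_smul₀ hC0.ne'] at h2

section Topological

variable [TopologicalSpace X] [CompactSpace X]

theorem isCompact_aeSupport (u : Lp ℝ 2 μ) : IsCompact (aeSupport u) := by
  refine IsClosed.isCompact ?_
  rw [← isOpen_compl_iff, isOpen_iff_mem_nhds]
  intro x hx
  simp only [aeSupport, Set.mem_compl_iff, Set.mem_ofPred_eq, not_forall, not_not] at hx
  obtain ⟨V, hV, h⟩ := hx
  filter_upwards [eventually_mem_nhds_iff.2 hV] with y hy
  simp only [aeSupport, Set.mem_compl_iff, Set.mem_ofPred_eq, not_forall, not_not]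
  exact ⟨V, hy, h⟩

variable {E} [IsFiniteMeasure μ]

/-- On a compact space regularity gives `v` in the domain uniformly within `1/2` of `1`; then `2v ≥
1`, and the unit contraction cuts it down to exactly `1`. -/
theorem oneL2_mem_domain (hreg : E.IsRegular) : oneL2 μ ∈ E.domain := by
  obtain ⟨ψ, v, -, -, hv, h⟩ := hreg.2 (fun _ => 1) continuous_const
    (HasCompactSupport.of_compactSpace _) (1 / 2) (by norm_num)
  obtain ⟨w, hw, -⟩ := E.markov ((2 : ℝ) • v)
  have e : oneL2 μ = w := by
    refine Lp.ext ?_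
    filter_upwards [hw, hv, coeFn_oneL2 (μ := μ), Lp.coeFn_smul (2 : ℝ) (v : Lp ℝ 2 μ)]
      with x h1 h2 h3 h4
    rw [h1, h3, Submodule.coe_smul, h4, Pi.smul_apply, h2, smul_eq_mul]
    have := (abs_lt.1 (h x)).2
    rw [max_eq_left (by linarith), min_eq_right (by linarith)]
  rw [e]
  exact w.2

theorem form_oneL2 (hreg : E.IsRegular) (hloc : E.IsStrictlyLocal) (u : E.domain) :
    E.form u ⟨oneL2 μ, oneL2_mem_domain hreg⟩ = 0 :=
  hloc _ _ (isCompact_aeSupport _) (isCompact_aeSupport _)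
    ⟨Set.univ, 1, isOpen_univ, Set.subset_univ _, by
      filter_upwards [coeFn_oneL2 (μ := μ)] with x hx _ using hx⟩

theorem isMarkov_resolvent (hreg : E.IsRegular) (hloc : E.IsStrictlyLocal) {l : ℝ} (hl : 0 < l) :
    IsMarkov (l • E.resolvent l) where
  nonneg _ hf := E.smul_resolvent_nonneg hl hf
  map_one := by
    have h := E.eq_resolvent hl (l⁻¹ • ⟨oneL2 μ, oneL2_mem_domain hreg⟩) (oneL2 μ) fun φ => by
      rw [map_smul, LinearMap.smul_apply, E.symm, form_oneL2 hreg hloc, Submodule.coe_smul,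
        smul_inv_smul₀ hl.ne', sub_self, inner_zero_left, smul_zero]
    rw [smul_apply, ← h, Submodule.coe_smul, smul_inv_smul₀ hl.ne']
  symm f g := by
    rw [smul_apply, smul_apply, real_inner_smul_left, real_inner_smul_right]
    congr 1
    exact ContinuousLinearMap.isSelfAdjoint_iff_isSymmetric.1
      (E.resolventFamily.isSelfAdjoint l hl) f g

theorem isMarkov_heatCLM (hreg : E.IsRegular) (hloc : E.IsStrictlyLocal) {t : ℝ} (ht : 0 ≤ t) :
    IsMarkov (E.heatCLM t) := by
  have key : ∀ l : ℝ, 0 < l →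
      (∀ f, 0 ≤ f → 0 ≤ NormedSpace.exp (t • yosida E.generator l) f) ∧
      NormedSpace.exp (t • yosida E.generator l) (oneL2 μ) = oneL2 μ := fun l hl => by
    rw [E.resolventFamily.yosida_eq hl, smul_smul]
    exact isMarkov_exp (isMarkov_resolvent hreg hloc hl) (by positivity)
  refine ⟨fun f hf => ?_, ?_, E.resolventFamily.inner_semigroup ht⟩
  · refine ge_of_tendsto (E.resolventFamily.tendsto_semigroup ht f) ?_
    filter_upwards [eventually_gt_atTop 0] with l hl
    exact (key l hl).1 f hf
  · refine tendsto_nhds_unique (E.resolventFamily.tendsto_semigroup ht _)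
      (tendsto_const_nhds.congr' ?_)
    filter_upwards [eventually_gt_atTop 0] with l hl
    exact (key l hl).2.symm

/-- `inner_sq_sub_le` for `T = l R_l`, multiplied by `l`, bounds the approximating energies of `u²`
by `4 M² E(u, u)` uniformly in `l`. -/
theorem mulL2_self_mem_domain (hreg : E.IsRegular) (hloc : E.IsStrictlyLocal) {u : Lp ℝ 2 μ}
    (hu : u ∈ E.domain) (hb : EssBounded u) : mulL2 u u ∈ E.domain := by
  obtain ⟨M, hM⟩ := hb
  refine E.mem_domain_of_approxEnergy_le (K := 4 * M ^ 2 * E.form ⟨u, hu⟩ ⟨u, hu⟩) fun l hl => ?_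
  have h1 := (isMarkov_resolvent hreg hloc hl).inner_sq_sub_le hM
  have h2 := E.approxEnergy_le hl ⟨u, hu⟩
  rw [approxEnergy] at h2 ⊢
  calc _ ≤ l * (4 * M ^ 2 * inner ℝ (u - l • E.resolvent l u) u) :=
        mul_le_mul_of_nonneg_left h1 hl.le
    _ = 4 * M ^ 2 * (l * inner ℝ (u - l • E.resolvent l u) u) := by ring
    _ ≤ _ := mul_le_mul_of_nonneg_left h2 (by positivity)

theorem mulL2_mem_domain (hreg : E.IsRegular) (hloc : E.IsStrictlyLocal) {u v : Lp ℝ 2 μ}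
    (hu : u ∈ E.domain) (hv : v ∈ E.domain) (hub : EssBounded u) (hvb : EssBounded v) :
    mulL2 u v ∈ E.domain := by
  have h1 := mulL2_self_mem_domain hreg hloc hu hub
  have h2 := mulL2_self_mem_domain hreg hloc hv hvb
  have h3 := mulL2_self_mem_domain hreg hloc (E.domain.add_mem hu hv) (hub.add hvb)
  have e : mulL2 u v = (2 : ℝ)⁻¹ • (mulL2 (u + v) (u + v) - mulL2 u u - mulL2 v v) := by
    refine Lp.ext ?_
    filter_upwards [coeFn_mulL2 hub v, coeFn_mulL2 hub u, coeFn_mulL2 hvb v,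
      coeFn_mulL2 (hub.add hvb) (u + v), Lp.coeFn_add u v,
      Lp.coeFn_smul (2 : ℝ)⁻¹ (mulL2 (u + v) (u + v) - mulL2 u u - mulL2 v v),
      Lp.coeFn_sub (mulL2 (u + v) (u + v) - mulL2 u u) (mulL2 v v),
      Lp.coeFn_sub (mulL2 (u + v) (u + v)) (mulL2 u u)] with x a1 a2 a3 a4 a5 a6 a7 a8
    rw [a6, Pi.smul_apply, a7, Pi.sub_apply, a8, Pi.sub_apply, a4, a3, a2, a1, a5, Pi.add_apply,
      smul_eq_mul]
    ring
  rw [e]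
  exact E.domain.smul_mem _ (E.domain.sub_mem (E.domain.sub_mem h3 h1) h2)

end Topological

end DirichletForm

end DirichletSpace
end

/-! ### The gradient bound for the heat flow of bounded functions -/

noncomputable section

namespace DirichletSpace

open DirichletForm

section Calculus

variable {X : Type*} [MeasurableSpace X] {μ : Measure X}

theorem norm_mulL2_self_sub_le {u v : Lp ℝ 2 μ} {M : ℝ} (hu : ∀ᵐ x ∂μ, |u x| ≤ M)
    (hv : ∀ᵐ x ∂μ, |v x| ≤ M) : ‖mulL2 u u - mulL2 v v‖ ≤ 2 * M * ‖u - v‖ := by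
  have e : mulL2 u u - mulL2 v v = mulL2 u (u - v) + mulL2 v (u - v) := by
    rw [map_sub, map_sub, mulL2_comm (u := v) (v := u) ⟨M, hv⟩ ⟨M, hu⟩]
    abel
  rw [e]
  linarith [norm_add_le (mulL2 u (u - v)) (mulL2 v (u - v)), norm_mulL2_le hu (u - v),
    norm_mulL2_le hv (u - v)]

theorem tendsto_mulL2_self {ι : Type*} {l : Filter ι} {U : ι → Lp ℝ 2 μ} {u : Lp ℝ 2 μ} {M : ℝ}
    (hU : ∀ᶠ i in l, ∀ᵐ x ∂μ, |U i x| ≤ M) (hu : ∀ᵐ x ∂μ, |u x| ≤ M) (h : Tendsto U l (𝓝 u)) :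
    Tendsto (fun i => mulL2 (U i) (U i)) l (𝓝 (mulL2 u u)) := by
  rw [tendsto_iff_norm_sub_tendsto_zero] at h ⊢
  refine squeeze_zero' (Eventually.of_forall fun _ => norm_nonneg _) ?_
    (mul_zero (2 * M) ▸ h.const_mul (2 * M))
  filter_upwards [hU] with i hi
  exact norm_mulL2_self_sub_le hi hu

/-- `U²` need not be differentiable in `L²`, because `U'` may be unbounded. So split `H ρ = (H ρ - H
r) + H r`: the first part needs only continuity of `U²`, and the second is the bounded quadratic
form `U ↦ ⟨H r · U, U⟩`. -/
theorem hasDerivAt_inner_mulL2_self {H U : ℝ → Lp ℝ 2 μ} {H' U' : Lp ℝ 2 μ} {r M : ℝ}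
    (hH : HasDerivAt H H' r) (hU : HasDerivAt U U' r)
    (hUb : ∀ᶠ ρ in 𝓝 r, ∀ᵐ x ∂μ, |U ρ x| ≤ M) (hHb : EssBounded (H r)) :
    HasDerivAt (fun ρ => inner ℝ (H ρ) (mulL2 (U ρ) (U ρ)))
      (inner ℝ H' (mulL2 (U r) (U r)) + 2 * inner ℝ U' (mulL2 (H r) (U r))) r := by
  have hb := hUb.self_of_nhds
  have h1 : HasDerivAt (fun ρ => inner ℝ (H ρ - H r) (mulL2 (U ρ) (U ρ)))
      (inner ℝ H' (mulL2 (U r) (U r))) r := by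
    rw [hasDerivAt_iff_tendsto_slope] at hH ⊢
    have hc : Tendsto (fun ρ => mulL2 (U ρ) (U ρ)) (𝓝[≠] r) (𝓝 (mulL2 (U r) (U r))) :=
      (tendsto_mulL2_self hUb hb hU.continuousAt.tendsto).mono_left nhdsWithin_le_nhds
    refine (hH.inner hc).congr fun ρ => ?_
    rw [slope_def_module, slope_def_module, sub_self, inner_zero_left, sub_zero,
      real_inner_smul_left, smul_eq_mul]
  have h2 : HasDerivAt (fun ρ => inner ℝ (mulL2 (H r) (U ρ)) (U ρ))
      (2 * inner ℝ U' (mulL2 (H r) (U r))) r := by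
    refine (((mulL2 (H r)).hasFDerivAt.comp_hasDerivAt r hU).inner ℝ hU).congr_deriv ?_
    rw [inner_mulL2 hHb, real_inner_comm U']
    simp only [Function.comp_apply]
    ring
  refine ((h1.add h2).congr_of_eventuallyEq ?_)
  filter_upwards [hUb] with ρ hρ
  rw [Pi.add_apply, inner_sub_left, mulL2_comm (u := H r) hHb ⟨M, hρ⟩, inner_mulL2 ⟨M, hρ⟩]
  ring

end Calculus

namespace DirichletForm

variable {X : Type*} [MeasurableSpace X] {μ : Measure X} (E : DirichletForm μ)

/-- An element of the domain of the generator as an element of the form domain. -/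
def generatorToDomain (x : E.generator.domain) : E.domain := ⟨x, E.generator_domain_le x.2⟩

/-- The heat flow of an element of the domain of the generator. -/
def heatGen {t : ℝ} (ht : 0 ≤ t) (x : E.generator.domain) : E.generator.domain :=
  ⟨E.heatCLM t x, (E.resolventFamily.semigroup_mem_domain ht x).1⟩

theorem generator_heatGen {t : ℝ} (ht : 0 ≤ t) (x : E.generator.domain) :
    E.generator (E.heatGen ht x) = E.heatCLM t (E.generator x) :=
  (E.resolventFamily.semigroup_mem_domain ht x).2

theorem resolvent_mem_generator {l : ℝ} (hl : 0 < l) (f : Lp ℝ 2 μ) :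
    l • E.resolvent l f ∈ E.generator.domain := by
  obtain ⟨x, hx, -⟩ := (E.isResolvent_resolvent hl).1 f
  rw [← hx]
  exact E.generator.domain.smul_mem l x.2

end DirichletForm

namespace CarreDuChamp

variable {X : Type*} [MeasurableSpace X] {μ : Measure X} {E : DirichletForm μ}
  (G : CarreDuChamp E)

/-- The length `√Γ(u)` of the gradient. -/
def gradNorm (u : E.domain) : Lp ℝ 2 μ := sqrtL2 (G.gamma u u)

theorem coeFn_gradNorm (u : E.domain) :
    G.gradNorm u =ᵐ[μ] fun x => Real.sqrt (G.gamma u u x) :=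
  MemLp.coeFn_toLp (memLp_two_sqrt (G.gamma u u))

theorem gradNorm_nonneg (u : E.domain) : 0 ≤ G.gradNorm u := by
  rw [← Lp.coeFn_nonneg]
  filter_upwards [G.coeFn_gradNorm u] with x hx
  rw [hx]
  exact Real.sqrt_nonneg _

theorem inner_mulL2_gradNorm {h : Lp ℝ 2 μ} (hh : EssBounded h) (u : E.domain) :
    inner ℝ (mulL2 h (G.gradNorm u)) (G.gradNorm u) = ∫ x, h x * G.gamma u u x ∂μ := by
  rw [inner_eq_integral_mul]
  refine integral_congr_ae ?_
  filter_upwards [coeFn_mulL2 hh (G.gradNorm u), G.coeFn_gradNorm u, G.nonneg u] with x h1 h2 h3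
  rw [h1, h2, mul_assoc, Real.mul_self_sqrt h3]

theorem WeakBakryEmery.le {G : CarreDuChamp E} {C₁ : ℝ} (hBE : G.WeakBakryEmery C₁ 0) {t : ℝ}
    (ht : 0 ≤ t) (f : E.generator.domain) :
    ∀ᵐ x ∂μ, G.gradNorm (E.generatorToDomain (E.heatGen ht f)) x ≤
      C₁ * E.heatCLM t (G.gradNorm (E.generatorToDomain f)) x := by
  have hm : E.heat t (E.generatorToDomain f) ∈ E.domain := by
    rw [E.heat_eq ht]
    exact E.generator_domain_le (E.heatGen ht f).2
  have h := hBE (E.generatorToDomain f) t ht hm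
  have e : (⟨E.heat t (E.generatorToDomain f), hm⟩ : E.domain) =
      E.generatorToDomain (E.heatGen ht f) := Subtype.ext (E.heat_eq ht _)
  rw [e, E.heat_eq ht, zero_mul, Real.exp_zero, mul_one] at h
  exact h

variable [TopologicalSpace X] [CompactSpace X] [IsFiniteMeasure μ]

/-- The identity defining `Γ`, with `f = g = u` and the energies rewritten through `Δ`; it applies
because `u²` and `u h` lie in the form domain. -/
theorem two_mul_inner_gradNorm (hreg : E.IsRegular) (hloc : E.IsStrictlyLocal)
    (u h : E.generator.domain) (hu : EssBounded (u : Lp ℝ 2 μ)) (hh : EssBounded (h : Lp ℝ 2 μ)) :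
    2 * inner ℝ (mulL2 h (G.gradNorm (E.generatorToDomain u)))
      (G.gradNorm (E.generatorToDomain u)) =
    inner ℝ (E.generator h) (mulL2 (u : Lp ℝ 2 μ) u) -
      2 * inner ℝ (E.generator u) (mulL2 (h : Lp ℝ 2 μ) u) := by
  have hu' := E.generator_domain_le u.2
  have hh' := E.generator_domain_le h.2
  have h1 := G.integral_eq (E.generatorToDomain u) (E.generatorToDomain u)
    (E.generatorToDomain h) ⟨_, mulL2_mem_domain hreg hloc hu' hu' hu hu⟩
    ⟨_, mulL2_mem_domain hreg hloc hu' hh' hu hh⟩ ⟨_, mulL2_mem_domain hreg hloc hu' hh' hu hh⟩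
    hu hu hh (coeFn_mulL2 hu _) (coeFn_mulL2 hu _) (coeFn_mulL2 hu _)
  rw [G.inner_mulL2_gradNorm hh]
  refine h1.trans ?_
  rw [E.symm _ (E.generatorToDomain u), generatorToDomain, generatorToDomain, E.form_generator,
    E.form_generator]
  dsimp only
  rw [mulL2_comm hu hh]
  ring

theorem inner_gradNorm_heat_le (hreg : E.IsRegular) (hloc : E.IsStrictlyLocal) {C₁ : ℝ}
    (hBE : G.WeakBakryEmery C₁ 0) {t : ℝ} (ht : 0 ≤ t) (f : E.generator.domain)
    {h : Lp ℝ 2 μ} (hh : EssBounded h) (h0 : 0 ≤ h) :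
    inner ℝ (mulL2 h (G.gradNorm (E.generatorToDomain (E.heatGen ht f))))
      (G.gradNorm (E.generatorToDomain (E.heatGen ht f))) ≤
    C₁ ^ 2 * inner ℝ (mulL2 (E.heatCLM t h) (G.gradNorm (E.generatorToDomain f)))
      (G.gradNorm (E.generatorToDomain f)) := by
  set W := G.gradNorm (E.generatorToDomain (E.heatGen ht f))
  set F := G.gradNorm (E.generatorToDomain f)
  have h1 := (isMarkov_heatCLM hreg hloc ht).inner_mul_apply_sq_le hh h0 (G.gradNorm_nonneg _ :
    0 ≤ F)
  refine le_trans ?_ (mul_le_mul_of_nonneg_left h1 (sq_nonneg _))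
  rw [inner_eq_integral_mul, inner_eq_integral_mul, ← integral_const_mul]
  refine integral_mono_ae (integrable_mul _ _) ((integrable_mul _ _).const_mul _) ?_
  filter_upwards [hBE.le ht f, (Lp.coeFn_nonneg _).2 (G.gradNorm_nonneg _ : 0 ≤ W),
    coeFn_mulL2 hh W, coeFn_mulL2 hh (E.heatCLM t F), (Lp.coeFn_nonneg h).2 h0]
    with x h1 h2 h3 h4 h5
  rw [h3, h4]
  change W x ≤ C₁ * E.heatCLM t F x at h1
  have h6 : W x * W x ≤ (C₁ * E.heatCLM t F x) * (C₁ * E.heatCLM t F x) :=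
    mul_self_le_mul_self h2 h1
  have h7 := mul_le_mul_of_nonneg_left h6 h5
  linarith

theorem two_mul_inner_gradNorm_heat_le (hreg : E.IsRegular) (hloc : E.IsStrictlyLocal) {C₁ : ℝ}
    (hC₁ : 0 < C₁) (hBE : G.WeakBakryEmery C₁ 0) {s : ℝ} (hs : 0 ≤ s) (g h : E.generator.domain)
    (hg : ∀ᵐ x ∂μ, |(g : Lp ℝ 2 μ) x| ≤ 1) (hh : EssBounded (h : Lp ℝ 2 μ))
    (h0 : 0 ≤ (h : Lp ℝ 2 μ)) :
    2 * s * inner ℝ (mulL2 (h : Lp ℝ 2 μ) (G.gradNorm (E.generatorToDomain (E.heatGen hs g))))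
      (G.gradNorm (E.generatorToDomain (E.heatGen hs g))) ≤
      C₁ ^ 2 * inner ℝ (oneL2 μ) (h : Lp ℝ 2 μ) := by
  set W := G.gradNorm (E.generatorToDomain (E.heatGen hs g))
  set I : ℝ := inner ℝ (mulL2 (h : Lp ℝ 2 μ) W) W
  have hP : ∀ {t : ℝ}, 0 ≤ t → IsMarkov (E.heatCLM t) := fun ht => isMarkov_heatCLM hreg hloc ht
  -- The interpolation `∫ P_r h (P_{s-r} g)²`. Its derivative `2 ∫ P_r h Γ(P_{s-r} g)` is at least
  -- `2 I / C₁²` by Bakry-Émery over time `r`, since `P_r P_{s-r} g = P_s g`.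
  set φ : ℝ → ℝ := fun r => inner ℝ (E.heatCLM r h)
    (mulL2 (E.heatCLM (s - r) g) (E.heatCLM (s - r) g)) with hφ
  have hcont : ContinuousOn φ (Set.Icc 0 s) := by
    have c1 : ContinuousOn (fun r => E.heatCLM r (h : Lp ℝ 2 μ)) (Set.Icc 0 s) :=
      (E.resolventFamily.continuousOn_semigroup (h : Lp ℝ 2 μ)).mono Set.Icc_subset_Ici_self
    have c2 : ContinuousOn (fun r => E.heatCLM (s - r) (g : Lp ℝ 2 μ)) (Set.Icc 0 s) :=
      (E.resolventFamily.continuousOn_semigroup (g : Lp ℝ 2 μ)).comp (by fun_prop)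
        fun r hr => sub_nonneg.2 hr.2
    have c3 : ContinuousOn (fun r => mulL2 (E.heatCLM (s - r) (g : Lp ℝ 2 μ))
        (E.heatCLM (s - r) (g : Lp ℝ 2 μ))) (Set.Icc 0 s) := fun r hr =>
      tendsto_mulL2_self (M := 1)
        (by filter_upwards [self_mem_nhdsWithin] with ρ hρ
            exact (hP (sub_nonneg.2 hρ.2)).abs_le hg)
        ((hP (sub_nonneg.2 hr.2)).abs_le hg) (c2 r hr)
    exact c1.inner c3
  have hderiv : ∀ r ∈ Set.Ioo 0 s, ∃ d, HasDerivAt φ d r ∧ 2 * I / C₁ ^ 2 ≤ d := by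
    intro r hr
    have hr0 : 0 ≤ r := hr.1.le
    have hsr : 0 ≤ s - r := sub_nonneg.2 hr.2.le
    set hr' := E.heatGen hr0 h
    set u := E.heatGen hsr g
    have hub : EssBounded (u : Lp ℝ 2 μ) := ⟨1, (hP hsr).abs_le hg⟩
    have hhb : EssBounded (hr' : Lp ℝ 2 μ) := (hP hr0).essBounded hh
    have d1 : HasDerivAt (fun ρ => E.heatCLM ρ (h : Lp ℝ 2 μ)) (E.generator hr') r := by
      rw [E.generator_heatGen]
      exact E.resolventFamily.hasDerivAt_semigroup hr.1 h
    have d2 : HasDerivAt (fun ρ => E.heatCLM (s - ρ) (g : Lp ℝ 2 μ)) (-E.generator u) r := by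
      rw [E.generator_heatGen]
      have := (E.resolventFamily.hasDerivAt_semigroup (sub_pos.2 hr.2) g).scomp r
        ((hasDerivAt_id r).const_sub s)
      exact this.congr_deriv (by rw [neg_smul, one_smul]; rfl)
    have d3 := hasDerivAt_inner_mulL2_self (M := 1) d1 d2 (by
      filter_upwards [Iio_mem_nhds hr.2] with ρ hρ
      exact (hP (sub_nonneg.2 (le_of_lt hρ))).abs_le hg) hhb
    refine ⟨_, d3, ?_⟩
    have e := G.two_mul_inner_gradNorm hreg hloc u hr' hub hhb
    have e2 := G.inner_gradNorm_heat_le hreg hloc hBE hr0 u hh h0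
    have e3 : E.heatGen hr0 u = E.heatGen hs g := by
      refine Subtype.ext ?_
      change E.heatCLM r (E.heatCLM (s - r) g) = E.heatCLM s g
      have := E.resolventFamily.semigroup_add hr0 hsr (g : Lp ℝ 2 μ)
      rw [add_sub_cancel] at this
      exact this.symm
    rw [e3] at e2
    rw [div_le_iff₀ (by positivity), inner_neg_left]
    change I ≤ C₁ ^ 2 * inner ℝ (mulL2 (hr' : Lp ℝ 2 μ) _) _ at e2
    change _ ≤ (inner ℝ (E.generator hr') (mulL2 (u : Lp ℝ 2 μ) u) +
      2 * -inner ℝ (E.generator u) (mulL2 (hr' : Lp ℝ 2 μ) u)) * C₁ ^ 2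
    linear_combination 2 * e2 + C₁ ^ 2 * e
  have h1 := (convex_Icc 0 s).mul_sub_le_image_sub_of_le_deriv hcont
    (fun r hr => by
      rw [interior_Icc] at hr
      obtain ⟨d, hd, -⟩ := hderiv r hr
      exact hd.differentiableAt.differentiableWithinAt)
    (C := 2 * I / C₁ ^ 2) (fun r hr => by
      rw [interior_Icc] at hr
      obtain ⟨d, hd, hd2⟩ := hderiv r hr
      rwa [hd.deriv]) 0 ⟨le_rfl, hs⟩ s ⟨hs, le_rfl⟩ hs
  have h2 : 0 ≤ φ 0 := by
    simp only [hφ]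
    refine inner_nonneg ((hP le_rfl).nonneg _ h0) ?_
    rw [← Lp.coeFn_nonneg]
    have hs0 : 0 ≤ s - 0 := by linarith
    filter_upwards [coeFn_mulL2 ((hP hs0).essBounded ⟨1, hg⟩) (E.heatCLM (s - 0) g)] with x hx
    rw [hx]
    exact mul_self_nonneg _
  have h3 : φ s ≤ inner ℝ (oneL2 μ) (h : Lp ℝ 2 μ) := by
    simp only [hφ, sub_self]
    rw [← (hP hs).inner_one, real_inner_comm, ← sub_nonneg, ← inner_sub_left]
    refine inner_nonneg ?_ ((hP hs).nonneg _ h0)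
    have e : E.heatCLM 0 (g : Lp ℝ 2 μ) = g := E.resolventFamily.semigroup_zero _
    rw [e, sub_nonneg, ← Lp.coeFn_le]
    filter_upwards [coeFn_mulL2 ⟨1, hg⟩ (g : Lp ℝ 2 μ), hg, coeFn_oneL2 (μ := μ)] with x a1 a2 a3
    rw [a1, a3, ← abs_mul_abs_self]
    exact mul_le_one₀ a2 (abs_nonneg _) a2
  have h4 : 2 * I / C₁ ^ 2 * (s - 0) ≤ inner ℝ (oneL2 μ) (h : Lp ℝ 2 μ) := by linarith
  rw [div_mul_eq_mul_div, div_le_iff₀ (by positivity)] at h4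
  linarith

/-- Test `two_mul_inner_gradNorm_heat_le` with the indicator of `{W > c}`, approximated by `l R_l h`
to land in the domain of `Δ`. In the limit `W² - c²`, after truncation of `W`, has nonpositive
integral over a set where it is positive, so the set is null. -/
theorem gradNorm_heat_le (hreg : E.IsRegular) (hloc : E.IsStrictlyLocal) {C₁ : ℝ}
    (hC₁ : 0 < C₁) (hBE : G.WeakBakryEmery C₁ 0) {s : ℝ} (hs : 0 < s) (g : E.generator.domain)
    (hg : ∀ᵐ x ∂μ, |(g : Lp ℝ 2 μ) x| ≤ 1) :
    ∀ᵐ x ∂μ, G.gradNorm (E.generatorToDomain (E.heatGen hs.le g)) x ≤ C₁ / Real.sqrt (2 * s) := by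
  set W := G.gradNorm (E.generatorToDomain (E.heatGen hs.le g))
  set c := C₁ / Real.sqrt (2 * s)
  have hc : 0 < c := by positivity
  have hc2 : c ^ 2 = C₁ ^ 2 / (2 * s) := by
    rw [div_pow, Real.sq_sqrt (by positivity)]
  have hW0 : ∀ᵐ x ∂μ, 0 ≤ W x := (Lp.coeFn_nonneg _).2 (G.gradNorm_nonneg _)
  -- `l R_l h` converges to `h` only in `L²`, while `W²` is merely integrable. Truncation puts the
  -- square in `L²`, and a level above `c` keeps `V > c` wherever `W > c`.
  have hVm : MemLp (fun x => min (W x) (c + 1)) 2 μ :=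
    (Lp.memLp W).of_le ((Lp.aestronglyMeasurable W).inf aestronglyMeasurable_const) <| by
      filter_upwards [hW0] with x hx
      have : 0 ≤ min (W x) (c + 1) := le_min hx (by positivity)
      rw [Real.norm_of_nonneg this, Real.norm_of_nonneg hx]
      exact min_le_left _ _
  set V : Lp ℝ 2 μ := hVm.toLp _
  have hV : V =ᵐ[μ] fun x => min (W x) (c + 1) := hVm.coeFn_toLp
  have hVb : EssBounded V := ⟨c + 1, by
    filter_upwards [hV, hW0] with x h1 h2
    rw [h1, abs_of_nonneg (le_min h2 (by positivity))]
    exact min_le_right _ _⟩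
  set S : Set X := {x | c < W x}
  have hS : MeasurableSet S := measurableSet_lt measurable_const (Lp.stronglyMeasurable W).measurable
  set h : Lp ℝ 2 μ := indicatorConstLp 2 hS (measure_ne_top μ S) (1 : ℝ)
  have hh : h =ᵐ[μ] S.indicator fun _ => 1 := indicatorConstLp_coeFn
  have h01 : ∀ᵐ x ∂μ, 0 ≤ h x ∧ |h x| ≤ 1 := by
    filter_upwards [hh] with x hx
    rw [hx]
    by_cases hxS : x ∈ S <;> simp [hxS]
  have h0 : 0 ≤ h := (Lp.coeFn_nonneg _).1 (h01.mono fun x hx => hx.1)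
  have key : ∀ l : ℝ, 0 < l → inner ℝ (l • E.resolvent l h) (mulL2 V V) ≤
      c ^ 2 * inner ℝ (oneL2 μ) (l • E.resolvent l h) := by
    intro l hl
    set k := l • E.resolvent l h
    have hM := isMarkov_resolvent hreg hloc hl
    have hk0 : 0 ≤ k := hM.nonneg _ h0
    have hkb : EssBounded k := ⟨1, hM.abs_le (h01.mono fun x hx => hx.2)⟩
    have h1 := G.two_mul_inner_gradNorm_heat_le hreg hloc hC₁ hBE hs.le g
      ⟨k, E.resolvent_mem_generator hl h⟩ hg hkb hk0
    change 2 * s * inner ℝ (mulL2 k W) W ≤ C₁ ^ 2 * inner ℝ (oneL2 μ) k at h1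
    rw [hc2, div_mul_eq_mul_div, le_div_iff₀ (by positivity), mul_comm]
    refine le_trans (mul_le_mul_of_nonneg_left ?_ (by positivity)) h1
    rw [inner_eq_integral_mul, inner_eq_integral_mul]
    refine integral_mono_ae (integrable_mul _ _) (integrable_mul _ _) ?_
    filter_upwards [coeFn_mulL2 hVb V, coeFn_mulL2 hkb W, hV, hW0, (Lp.coeFn_nonneg k).2 hk0]
      with x a1 a2 a3 a4 a5
    rw [a1, a2, a3, mul_assoc]
    exact mul_le_mul_of_nonneg_left (mul_self_le_mul_self (le_min a4 (by positivity))
      (min_le_left _ _)) a5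
  have lim : inner ℝ h (mulL2 V V) ≤ c ^ 2 * inner ℝ (oneL2 μ) h := by
    have ht := E.tendsto_smul_resolvent h
    refine le_of_tendsto_of_tendsto (ht.inner tendsto_const_nhds)
      ((tendsto_const_nhds.inner ht).const_mul _) ?_
    filter_upwards [eventually_gt_atTop 0] with l hl
    exact key l hl
  have i1 := integrable_mul h (mulL2 V V)
  have i2 := (integrable_mul (oneL2 μ) h).const_mul (c ^ 2)
  rw [inner_eq_integral_mul, inner_eq_integral_mul, ← integral_const_mul, ← sub_nonpos,
    ← integral_sub i1 i2] at lim
  have hval : ∀ᵐ x ∂μ, h x * mulL2 V V x - c ^ 2 * (oneL2 μ x * h x) =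
      S.indicator (fun x => min (W x) (c + 1) ^ 2 - c ^ 2) x := by
    filter_upwards [coeFn_mulL2 hVb V, hV, hh, coeFn_oneL2 (μ := μ)] with x a1 a2 a3 a4
    rw [a1, a2, a3, a4]
    by_cases hxS : x ∈ S
    · rw [Set.indicator_of_mem hxS, Set.indicator_of_mem hxS]; ring
    · rw [Set.indicator_of_notMem hxS, Set.indicator_of_notMem hxS]; ring
  have hpos : ∀ x ∈ S, 0 < min (W x) (c + 1) ^ 2 - c ^ 2 := fun x hx => by
    have h1 : c < min (W x) (c + 1) := lt_min hx (by linarith)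
    have h2 : c ^ 2 < min (W x) (c + 1) ^ 2 := by gcongr
    linarith
  have hnn : 0 ≤ᵐ[μ] fun x => h x * mulL2 V V x - c ^ 2 * (oneL2 μ x * h x) := by
    filter_upwards [hval] with x hx
    rw [hx]
    exact Set.indicator_nonneg (fun y hy => (hpos y hy).le) x
  have hz := (integral_eq_zero_iff_of_nonneg_ae hnn (i1.sub i2)).1
    (le_antisymm lim (integral_nonneg_of_ae hnn))
  filter_upwards [hz, hval] with x h1 h2
  by_contra! hx
  have hx : x ∈ S := hx
  rw [h2, Set.indicator_of_mem hx] at h1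
  exact (hpos x hx).ne' h1

end CarreDuChamp

end DirichletSpace
end

/-! ### The exterior derivative, its adjoint, and pairing with the variation -/

noncomputable section

namespace DirichletSpace

open DirichletForm

namespace DirichletForm

variable {X : Type*} [MeasurableSpace X] {μ : Measure X} (E : DirichletForm μ)

theorem form_sub_self_le (u v : E.domain) :
    E.form (u - v) (u - v) ≤ 2 * E.form u u + 2 * E.form v v := by
  have h1 := E.nonneg (u + v)
  rw [E.form_sub_self]
  simp only [map_add, LinearMap.add_apply, E.symm v u] at h1
  linarith

theorem energyOne_nonneg (u : E.domain) : 0 ≤ E.energyOne u :=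
  add_nonneg (sq_nonneg _) (E.nonneg u)

theorem form_le_energyOne (u : E.domain) : E.form u u ≤ E.energyOne u :=
  le_add_of_nonneg_left (sq_nonneg _)

theorem abs_form_le (u v : E.domain) :
    |E.form u v| ≤ Real.sqrt (E.form u u) * Real.sqrt (E.form v v) := by
  have h : E.form u v ^ 2 ≤ E.form u u * E.form v v := by
    have h1 := discrim_le_zero (a := E.form v v) (b := 2 * E.form u v) (c := E.form u u) fun t => by
      have := E.nonneg (u + t • v)
      simp only [map_add, LinearMap.add_apply, map_smul, LinearMap.smul_apply, smul_eq_mul,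
        E.symm v u] at this
      linarith
    rw [discrim] at h1
    linarith
  rw [← Real.sqrt_mul (E.nonneg u)]
  exact Real.abs_le_sqrt h

theorem tendsto_coe_of_energyOne {f : ℕ → E.domain} {u : E.domain}
    (h : Tendsto (fun n => E.energyOne (f n - u)) atTop (𝓝 0)) :
    Tendsto (fun n => (f n : Lp ℝ 2 μ)) atTop (𝓝 (u : Lp ℝ 2 μ)) := by
  rw [tendsto_iff_norm_sub_tendsto_zero]
  have h2 : Tendsto (fun n => ‖(f n : Lp ℝ 2 μ) - u‖ ^ 2) atTop (𝓝 0) :=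
    squeeze_zero (fun _ => sq_nonneg _)
      (fun n => le_add_of_nonneg_right (E.nonneg (f n - u))) h
  have h3 := h2.sqrt
  simpa [Real.sqrt_sq (norm_nonneg _)] using h3

theorem tendsto_form_of_energyOne {f : ℕ → E.domain} {u : E.domain}
    (h : Tendsto (fun n => E.energyOne (f n - u)) atTop (𝓝 0)) :
    Tendsto (fun n => E.form (f n - u) (f n - u)) atTop (𝓝 0) :=
  squeeze_zero (fun _ => E.nonneg _) (fun _ => E.form_le_energyOne _) h

theorem tendsto_form_left {f : ℕ → E.domain} {u : E.domain}
    (h : Tendsto (fun n => E.energyOne (f n - u)) atTop (𝓝 0)) (v : E.domain) :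
    Tendsto (fun n => E.form (f n) v) atTop (𝓝 (E.form u v)) := by
  rw [tendsto_iff_norm_sub_tendsto_zero]
  have h1 := (E.tendsto_form_of_energyOne h).sqrt.mul_const (Real.sqrt (E.form v v))
  rw [Real.sqrt_zero, zero_mul] at h1
  refine squeeze_zero (fun _ => norm_nonneg _) (fun n => ?_) h1
  have e : E.form (f n) v - E.form u v = E.form (f n - u) v := by
    rw [map_sub, LinearMap.sub_apply]
  rw [e]
  exact E.abs_form_le (f n - u) v

variable [TopologicalSpace X] [CompactSpace X]

variable {E} in
theorem exists_tendsto_contDomain (hreg : E.IsRegular) (u : E.domain) :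
    ∃ f : ℕ → E.contDomain,
      Tendsto (fun n => E.energyOne ((f n : E.domain) - u)) atTop (𝓝 0) := by
  have h : ∀ n : ℕ, ∃ v : E.contDomain, E.energyOne ((v : E.domain) - u) < 1 / ((n : ℝ) + 1) := by
    intro n
    obtain ⟨φ, v, hφ, -, hv, h⟩ := hreg.1 u (1 / ((n : ℝ) + 1)) (by positivity)
    refine ⟨⟨v, BoundedContinuousFunction.mkOfCompact ⟨φ, hφ⟩, hv⟩, ?_⟩
    rw [energyOne, form_sub_self] at h ⊢
    rw [E.symm u v, Submodule.coe_sub, norm_sub_rev] at h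
    change ‖(v : Lp ℝ 2 μ) - u‖ ^ 2 + (E.form v v - 2 * E.form v u + E.form u u) < _
    linarith
  choose f hf using h
  exact ⟨f, squeeze_zero (fun _ => E.energyOne_nonneg _) (fun n => (hf n).le)
    tendsto_one_div_add_atTop_nhds_zero_nat⟩

end DirichletForm

namespace CarreDuChamp

variable {X : Type*} [MeasurableSpace X] {μ : Measure X} {E : DirichletForm μ}
  (G : CarreDuChamp E)

theorem tendsto_gamma {f : ℕ → E.domain} {u : E.domain}
    (h : Tendsto (fun n => E.energyOne (f n - u)) atTop (𝓝 0)) :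
    Tendsto (fun n => G.gamma (f n) (f n)) atTop (𝓝 (G.gamma u u)) := by
  obtain ⟨C, hC⟩ := G.continuous
  rw [tendsto_iff_norm_sub_tendsto_zero]
  have h1 : Tendsto (fun n => C * (Real.sqrt (E.energyOne (f n - u)) *
      Real.sqrt (E.energyOne (f n - u))) + 2 * (C * (Real.sqrt (E.energyOne u) *
      Real.sqrt (E.energyOne (f n - u))))) atTop (𝓝 0) := by
    have h2 := h.sqrt
    rw [Real.sqrt_zero] at h2
    simpa using ((h2.mul h2).const_mul C).add (((h2.const_mul (Real.sqrt (E.energyOne u))).const_mul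
      C).const_mul 2)
  refine squeeze_zero (fun _ => norm_nonneg _) (fun n => ?_) h1
  have e : G.gamma (f n) (f n) - G.gamma u u =
      G.gamma (f n - u) (f n - u) + (2 : ℝ) • G.gamma u (f n - u) := by
    simp only [map_sub, LinearMap.sub_apply, G.symm (f n) u]
    module
  rw [e]
  refine (norm_add_le _ _).trans (add_le_add (hC _ _) ?_)
  rw [norm_smul, Real.norm_of_nonneg zero_le_two]
  exact mul_le_mul_of_nonneg_left (hC _ _) zero_le_two

variable [TopologicalSpace X]

theorem essBounded_contDomain (f : E.contDomain) : EssBounded ((f : E.domain) : Lp ℝ 2 μ) := by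
  obtain ⟨φ, hφ⟩ := f.2
  refine ⟨‖φ‖, ?_⟩
  filter_upwards [hφ] with x hx
  rw [hx]
  exact φ.norm_coe_le_norm x

theorem fiberInner_derivCont (f g : E.contDomain) :
    G.fiberInner (G.derivCont f) (G.derivCont g) = G.gamma f g := by
  change G.fiberInner (G.tmul f 1 : G.PreForms) (G.tmul g 1 : G.PreForms) = _
  rw [fiberInner_coe, preFiber_tmul]
  refine Lp.ext ?_
  filter_upwards [coeFn_mulL1 ((1 : BddMeas X) * 1) (G.gamma f g)] with x hx
  rw [hx, mul_one]
  exact one_mul _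

variable [CompactSpace X] [IsFiniteMeasure μ]

/-- Take `h = 1` in the identity defining `Γ`; the term `E(1, f g)` vanishes by strict locality. -/
theorem inner_derivCont (hreg : E.IsRegular) (hloc : E.IsStrictlyLocal) (f g : E.contDomain) :
    inner ℝ (G.derivCont f) (G.derivCont g) = E.form f g := by
  have hf := essBounded_contDomain f
  have hg := essBounded_contDomain g
  have h := G.integral_eq f g ⟨oneL2 μ, oneL2_mem_domain hreg⟩
    ⟨_, mulL2_mem_domain hreg hloc (f : E.domain).2 (g : E.domain).2 hf hg⟩ f g hf hg
    essBounded_oneL2 (coeFn_mulL2 hf _)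
    (by filter_upwards [coeFn_oneL2 (μ := μ)] with x hx; rw [hx, mul_one])
    (by filter_upwards [coeFn_oneL2 (μ := μ)] with x hx; rw [hx, mul_one])
  rw [E.symm ⟨oneL2 μ, _⟩, form_oneL2 hreg hloc, E.symm (g : E.domain)] at h
  have e : ∫ x, oneL2 μ x * G.gamma f g x ∂μ = ∫ x, G.gamma f g x ∂μ := by
    refine integral_congr_ae ?_
    filter_upwards [coeFn_oneL2 (μ := μ)] with x hx
    rw [hx, one_mul]
  rw [inner_eq_integral_fiberInner, fiberInner_derivCont, ← e]
  linarith

theorem norm_derivCont_sq (hreg : E.IsRegular) (hloc : E.IsStrictlyLocal) (f : E.contDomain) :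
    ‖G.derivCont f‖ ^ 2 = E.form f f := by
  rw [← real_inner_self_eq_norm_sq, G.inner_derivCont hreg hloc]

omit [CompactSpace X] [IsFiniteMeasure μ] in
theorem preDeriv_graph : G.preDeriv.graph =
    LinearMap.range ((E.domain.subtype.comp E.contDomain.subtype).prod G.derivCont) := by
  refine Submodule.toLinearPMap_graph_eq _ ?_
  rintro _ ⟨f, rfl⟩ h
  have hf : f = 0 := Subtype.ext (Subtype.ext h)
  rw [hf, map_zero]
  rfl

omit [CompactSpace X] [IsFiniteMeasure μ] in
theorem mem_preDeriv_graph {p : Lp ℝ 2 μ × G.OneForms} :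
    p ∈ G.preDeriv.graph ↔ ∃ f : E.contDomain, (((f : E.domain) : Lp ℝ 2 μ), G.derivCont f) = p := by
  rw [preDeriv_graph]
  rfl

/-- If `f_n → 0` and `∂ f_n → η`, then `f_n` is `E₁`-Cauchy by `norm_derivCont_sq`. Its limit in the
closed form must be `0`, so `‖∂ f_n‖² = E(f_n, f_n) → 0`. -/
theorem preDeriv_isClosable (hreg : E.IsRegular) (hloc : E.IsStrictlyLocal) :
    G.preDeriv.IsClosable := by
  refine ⟨G.preDeriv.graph.topologicalClosure.toLinearPMap,
    (Submodule.toLinearPMap_graph_eq _ ?_).symm⟩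
  rintro ⟨x, η⟩ hp hx
  change x = 0 at hx
  change η = 0
  obtain ⟨p, hp, hlim⟩ := mem_closure_iff_seq_limit.1 hp
  choose f hf using fun n => G.mem_preDeriv_graph.1 (hp n)
  have h1 : Tendsto (fun n => ((f n : E.domain) : Lp ℝ 2 μ)) atTop (𝓝 x) := by
    have := (continuous_fst.tendsto _).comp hlim
    exact this.congr fun n => by rw [Function.comp_apply, ← hf n]
  have h2 : Tendsto (fun n => G.derivCont (f n)) atTop (𝓝 η) := by
    have := (continuous_snd.tendsto _).comp hlim
    exact this.congr fun n => by rw [Function.comp_apply, ← hf n]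
  obtain ⟨v, hv⟩ := E.closed (fun n => (f n : E.domain)) fun ε hε => by
    obtain ⟨N₁, hN₁⟩ := Metric.cauchySeq_iff.1 h1.cauchySeq (Real.sqrt (ε / 2)) (by positivity)
    obtain ⟨N₂, hN₂⟩ := Metric.cauchySeq_iff.1 h2.cauchySeq (Real.sqrt (ε / 2)) (by positivity)
    refine ⟨max N₁ N₂, fun m hm n hn => ?_⟩
    have h1 := hN₁ m ((le_max_left _ _).trans hm) n ((le_max_left _ _).trans hn)
    have h2 := hN₂ m ((le_max_right _ _).trans hm) n ((le_max_right _ _).trans hn)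
    rw [dist_eq_norm, Real.lt_sqrt (norm_nonneg _)] at h1 h2
    rw [← map_sub, G.norm_derivCont_sq hreg hloc, Submodule.coe_sub] at h2
    linarith
  have h3 := E.tendsto_coe_of_energyOne (f := fun n => (f n : E.domain)) hv
  have hv0 : v = 0 := Subtype.ext ((tendsto_nhds_unique h3 h1).trans hx)
  have h4 := (E.tendsto_form_of_energyOne (f := fun n => (f n : E.domain)) hv).sqrt
  simp only [hv0, sub_zero, Real.sqrt_zero] at h4
  refine tendsto_nhds_unique h2 (tendsto_zero_iff_norm_tendsto_zero.2 (h4.congr fun n => ?_))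
  rw [← G.norm_derivCont_sq hreg hloc, Real.sqrt_sq (norm_nonneg _)]

theorem deriv_graph (hreg : E.IsRegular) (hloc : E.IsStrictlyLocal) :
    G.deriv.graph = G.preDeriv.graph.topologicalClosure :=
  (G.preDeriv_isClosable hreg hloc).graph_closure_eq_closure_graph.symm

/-- Every element of the form domain is in the domain of `∂`. -/
theorem exists_mem_deriv_graph (hreg : E.IsRegular) (hloc : E.IsStrictlyLocal) (u : E.domain) :
    ∃ η : G.OneForms, ((u : Lp ℝ 2 μ), η) ∈ G.deriv.graph ∧ G.fiberInner η η = G.gamma u u ∧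
      ∀ g : E.contDomain, inner ℝ η (G.derivCont g) = E.form u g := by
  obtain ⟨f, hf⟩ := exists_tendsto_contDomain hreg u
  have h1 := E.tendsto_coe_of_energyOne hf
  have h2 := E.tendsto_form_of_energyOne hf
  have hc : CauchySeq fun n => G.derivCont (f n) := by
    rw [Metric.cauchySeq_iff]
    intro ε hε
    obtain ⟨N, hN⟩ := Metric.tendsto_atTop.1 h2 (ε ^ 2 / 4) (by positivity)
    refine ⟨N, fun m hm n hn => ?_⟩
    have hm := hN m hm
    have hn := hN n hn
    rw [Real.dist_eq, sub_zero, abs_of_nonneg (E.nonneg _)] at hm hn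
    rw [dist_eq_norm, ← map_sub]
    refine lt_of_pow_lt_pow_left₀ 2 hε.le ?_
    rw [G.norm_derivCont_sq hreg hloc, Submodule.coe_sub, ← sub_sub_sub_cancel_right _ _ u]
    have := E.form_sub_self_le ((f m : E.domain) - u) ((f n : E.domain) - u)
    linarith
  obtain ⟨η, hη⟩ := cauchySeq_tendsto_of_complete hc
  refine ⟨η, ?_, ?_, fun g => ?_⟩
  · rw [G.deriv_graph hreg hloc]
    exact mem_closure_of_tendsto (h1.prodMk_nhds hη)
      (Eventually.of_forall fun n => G.mem_preDeriv_graph.2 ⟨f n, rfl⟩)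
  · have h3 : Tendsto (fun n => G.fiberInner (G.derivCont (f n)) (G.derivCont (f n))) atTop
        (𝓝 (G.fiberInner η η)) := by
      have hcont : Continuous fun ζ => G.fiberInner ζ ζ := by fun_prop
      exact (hcont.tendsto η).comp hη
    simp only [fiberInner_derivCont] at h3
    exact tendsto_nhds_unique h3 (G.tendsto_gamma hf)
  · have h3 := hη.inner (𝕜 := ℝ) (tendsto_const_nhds (x := G.derivCont g))
    simp only [G.inner_derivCont hreg hloc] at h3
    exact tendsto_nhds_unique h3 (E.tendsto_form_left hf g)

theorem dense_deriv_domain (hreg : E.IsRegular) (hloc : E.IsStrictlyLocal) :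
    Dense (G.deriv.domain : Set (Lp ℝ 2 μ)) :=
  E.dense.mono fun u hu => by
    obtain ⟨η, hη, -⟩ := G.exists_mem_deriv_graph hreg hloc ⟨u, hu⟩
    exact G.deriv.mem_domain_of_mem_graph hη

/-- `∂* ∂ = -Δ` on the domain of `Δ`. -/
theorem exists_coderiv_eq (hreg : E.IsRegular) (hloc : E.IsStrictlyLocal)
    (x : E.generator.domain) : ∃ η : G.coderiv.domain,
      G.fiberInner (η : G.OneForms) η = G.gamma (E.generatorToDomain x) (E.generatorToDomain x) ∧
      G.coderiv η = - E.generator x := by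
  obtain ⟨η, -, hη, hη2⟩ := G.exists_mem_deriv_graph hreg hloc (E.generatorToDomain x)
  have h : ∀ y : G.deriv.domain,
      inner ℝ (-E.generator x) (y : Lp ℝ 2 μ) = inner ℝ η (G.deriv y) := by
    intro y
    have hy := G.deriv.mem_graph y
    rw [G.deriv_graph hreg hloc] at hy
    have hcl : IsClosed {p : Lp ℝ 2 μ × G.OneForms |
        inner ℝ (-E.generator x) p.1 = inner ℝ η p.2} :=
      isClosed_eq (by fun_prop) (by fun_prop)
    refine closure_minimal ?_ hcl hy
    intro p hp
    obtain ⟨f, rfl⟩ := G.mem_preDeriv_graph.1 hp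
    change inner ℝ (-E.generator x) ((f : E.domain) : Lp ℝ 2 μ) = inner ℝ η (G.derivCont f)
    rw [hη2, inner_neg_left, generatorToDomain, E.form_generator]
  refine ⟨⟨η, LinearPMap.mem_adjoint_domain_of_exists η ⟨_, h⟩⟩, hη, ?_⟩
  exact LinearPMap.adjoint_apply_eq (G.dense_deriv_domain hreg hloc) _ h

omit [CompactSpace X] [IsFiniteMeasure μ] in
theorem coeFn_fiberNorm (η : G.OneForms) :
    G.fiberNorm η =ᵐ[μ] fun x => Real.sqrt (G.fiberInner η η x) :=
  MemLp.coeFn_toLp (memLp_two_sqrt (G.fiberInner η η))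

/-- The form `-c⁻¹ ∂x` is admissible in the supremum; the sign is there because `∂*∂ = -Δ`. -/
theorem inner_generator_le (hreg : E.IsRegular) (hloc : E.IsStrictlyLocal)
    (x : E.generator.domain) {c : ℝ} (hc : 0 < c)
    (hx : ∀ᵐ y ∂μ, G.gradNorm (E.generatorToDomain x) y ≤ c) {f : Lp ℝ 2 μ}
    (hf : G.variation f < ∞) :
    inner ℝ f (E.generator x) ≤ c * (G.variation f).toReal := by
  obtain ⟨η, hη, hη2⟩ := G.exists_coderiv_eq hreg hloc x
  have h1 : ∀ᵐ y ∂μ, G.fiberNorm (((-c⁻¹) • η : G.coderiv.domain) : G.OneForms) y ≤ 1 := by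
    have e : G.fiberInner (((-c⁻¹) • η : G.coderiv.domain) : G.OneForms)
        (((-c⁻¹) • η : G.coderiv.domain) : G.OneForms) =
        (c⁻¹ ^ 2) • G.gamma (E.generatorToDomain x) (E.generatorToDomain x) := by
      rw [Submodule.coe_smul, map_smul, map_smul, smul_apply, hη, smul_smul]
      congr 1
      ring
    filter_upwards [hx, G.coeFn_fiberNorm (((-c⁻¹) • η : G.coderiv.domain) : G.OneForms),
      G.coeFn_gradNorm (E.generatorToDomain x),
      Lp.coeFn_smul (c⁻¹ ^ 2) (G.gamma (E.generatorToDomain x) (E.generatorToDomain x))]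
      with y h1 h2 h3 h4
    rw [h2, e, h4, Pi.smul_apply, smul_eq_mul, Real.sqrt_mul (sq_nonneg _),
      Real.sqrt_sq (by positivity), ← h3, inv_mul_le_iff₀ hc, mul_one]
    exact h1
  have h2 : ENNReal.ofReal (inner ℝ f (G.coderiv ((-c⁻¹) • η))) ≤ G.variation f :=
    le_iSup₂ (f := fun (η : G.coderiv.domain) (_ : ∀ᵐ x ∂μ, G.fiberNorm (η : G.OneForms) x ≤ 1) =>
      ENNReal.ofReal (inner ℝ f (G.coderiv η))) ((-c⁻¹) • η) h1
  rw [ENNReal.ofReal_le_iff_le_toReal hf.ne, LinearPMap.map_smul, hη2, neg_smul, smul_neg, neg_neg,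
    real_inner_smul_right, inv_mul_le_iff₀ hc] at h2
  exact h2

end CarreDuChamp

end DirichletSpace
end

/-! ### The `L¹` estimate by duality -/

noncomputable section

namespace DirichletSpace

open DirichletForm

namespace CarreDuChamp

variable {X : Type*} [MeasurableSpace X] {μ : Measure X} {E : DirichletForm μ}
  (G : CarreDuChamp E) [TopologicalSpace X] [CompactSpace X] [IsFiniteMeasure μ]

theorem inner_heat_sub_le_of_mem_generator (hreg : E.IsRegular) (hloc : E.IsStrictlyLocal)
    {C₁ : ℝ} (hC₁ : 0 < C₁) (hBE : G.WeakBakryEmery C₁ 0) {f : Lp ℝ 2 μ} (hf : G.variation f < ∞)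
    (g : E.generator.domain) (hg : ∀ᵐ x ∂μ, |(g : Lp ℝ 2 μ) x| ≤ 1) {t : ℝ} (ht : 0 ≤ t) :
    inner ℝ f (E.heatCLM t g - g) ≤ C₁ * Real.sqrt (2 * t) * (G.variation f).toReal := by
  set K := (G.variation f).toReal
  -- The subtracted term has derivative `C₁ K / √(2s)`, exactly the bound on `⟨f, Δ P_s g⟩`.
  -- Monotonicity of `θ` replaces an integration of a function singular at `0`.
  set θ : ℝ → ℝ := fun s => inner ℝ f (E.heatCLM s g) - C₁ * Real.sqrt (2 * s) * K with hθ
  have hcont : ContinuousOn θ (Set.Icc 0 t) := by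
    have c1 : ContinuousOn (fun r => E.heatCLM r (g : Lp ℝ 2 μ)) (Set.Icc 0 t) :=
      (E.resolventFamily.continuousOn_semigroup (g : Lp ℝ 2 μ)).mono Set.Icc_subset_Ici_self
    exact (continuousOn_const.inner c1).sub (by fun_prop)
  have hderiv : ∀ s ∈ Set.Ioo 0 t, ∃ d, HasDerivAt θ d s ∧ d ≤ 0 := by
    intro s hs
    have h1 := (hasDerivAt_const s f).inner ℝ (E.resolventFamily.hasDerivAt_semigroup hs.1 g)
    have h2 := ((((hasDerivAt_id s).const_mul 2).sqrt
      (by simpa using hs.1.ne')).const_mul C₁).mul_const K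
    refine ⟨_, h1.sub h2, ?_⟩
    have h3 := G.inner_generator_le hreg hloc (E.heatGen hs.1.le g) (div_pos hC₁
      (Real.sqrt_pos.2 (mul_pos two_pos hs.1)))
      (G.gradNorm_heat_le hreg hloc hC₁ hBE hs.1 g hg) hf
    rw [E.generator_heatGen] at h3
    rw [inner_zero_left, add_zero, sub_nonpos]
    refine h3.trans (le_of_eq ?_)
    simp only [id]
    field_simp
    rfl
  have h1 := antitoneOn_of_deriv_nonpos (convex_Icc 0 t) hcont
    (fun s hs => by
      rw [interior_Icc] at hs
      obtain ⟨d, hd, -⟩ := hderiv s hs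
      exact hd.differentiableAt.differentiableWithinAt)
    (fun s hs => by
      rw [interior_Icc] at hs
      obtain ⟨d, hd, hd2⟩ := hderiv s hs
      rwa [hd.deriv]) ⟨le_rfl, ht⟩ ⟨ht, le_rfl⟩ ht
  have e : E.heatCLM 0 (g : Lp ℝ 2 μ) = g := E.resolventFamily.semigroup_zero _
  simp only [hθ, e, mul_zero, Real.sqrt_zero, zero_mul, sub_zero] at h1
  rw [inner_sub_right]
  linarith

/-- Approximate `g` by `l R_l g`, which is in the domain of `Δ` and still bounded by `1` because `l
R_l` is Markov. -/
theorem inner_heat_sub_le (hreg : E.IsRegular) (hloc : E.IsStrictlyLocal)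
    {C₁ : ℝ} (hC₁ : 0 < C₁) (hBE : G.WeakBakryEmery C₁ 0) {f : Lp ℝ 2 μ} (hf : G.variation f < ∞)
    {g : Lp ℝ 2 μ} (hg : ∀ᵐ x ∂μ, |g x| ≤ 1) {t : ℝ} (ht : 0 ≤ t) :
    inner ℝ f (E.heatCLM t g - g) ≤ C₁ * Real.sqrt (2 * t) * (G.variation f).toReal := by
  have hlim := E.tendsto_smul_resolvent g
  refine le_of_tendsto (tendsto_const_nhds.inner
    ((((E.heatCLM t).continuous.tendsto g).comp hlim).sub hlim)) ?_
  filter_upwards [eventually_gt_atTop 0] with l hl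
  exact G.inner_heat_sub_le_of_mem_generator hreg hloc hC₁ hBE hf
    ⟨_, E.resolvent_mem_generator hl g⟩ ((isMarkov_resolvent hreg hloc hl).abs_le hg) ht

theorem integral_norm_heat_sub_le (hreg : E.IsRegular) (hloc : E.IsStrictlyLocal)
    {C₁ : ℝ} (hC₁ : 0 < C₁) (hBE : G.WeakBakryEmery C₁ 0) {f : Lp ℝ 2 μ} (hf : G.variation f < ∞)
    {t : ℝ} (ht : 0 ≤ t) :
    ∫ x, ‖(E.heatCLM t f - f : Lp ℝ 2 μ) x‖ ∂μ ≤
      C₁ * Real.sqrt (2 * t) * (G.variation f).toReal := by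
  set D : Lp ℝ 2 μ := E.heatCLM t f - f
  -- The sign of `D` is the dual function realising `‖D‖₁`; its value where `D = 0` is immaterial.
  have hm : Measurable fun x => if 0 ≤ D x then (1 : ℝ) else -1 :=
    Measurable.ite (measurableSet_le measurable_const (Lp.stronglyMeasurable D).measurable)
      measurable_const measurable_const
  have hb : ∀ x, ‖if 0 ≤ D x then (1 : ℝ) else -1‖ ≤ 1 := fun x => by split_ifs <;> simp
  have hmem : MemLp (fun x => if 0 ≤ D x then (1 : ℝ) else -1) 2 μ :=
    MemLp.of_bound hm.aestronglyMeasurable 1 (Eventually.of_forall hb)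
  have hg : hmem.toLp _ =ᵐ[μ] fun x => if 0 ≤ D x then (1 : ℝ) else -1 := hmem.coeFn_toLp
  have h1 := G.inner_heat_sub_le hreg hloc hC₁ hBE hf (g := hmem.toLp _)
    (by filter_upwards [hg] with x hx; rw [hx]; exact hb x) ht
  have h2 : inner ℝ f (E.heatCLM t (hmem.toLp _) - hmem.toLp _) = ∫ x, ‖D x‖ ∂μ := by
    rw [inner_sub_right, ← (isMarkov_heatCLM hreg hloc ht).symm, ← inner_sub_left,
      inner_eq_integral_mul]
    refine integral_congr_ae ?_
    filter_upwards [hg] with x hx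
    rw [hx, Real.norm_eq_abs]
    split_ifs with h
    · rw [mul_one, abs_of_nonneg h]
    · rw [mul_neg_one, abs_of_neg (not_le.1 h)]
  rwa [h2] at h1

end CarreDuChamp

end DirichletSpace

end

theorem mainTheorem7 {X : Type*} [MetricSpace X] [CompactSpace X] [MeasurableSpace X]
    [BorelSpace X] (μ : MeasureTheory.Measure X) [MeasureTheory.IsProbabilityMeasure μ]
    [μ.IsOpenPosMeasure]
    (E : DirichletSpace.DirichletForm μ) (hreg : E.IsRegular) (hloc : E.IsStrictlyLocal)
    (G : DirichletSpace.CarreDuChamp E) (C₁ : ℝ) (hC₁ : 1 ≤ C₁)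
    (hdom : G.SemigroupDomination C₁) (hBE : G.WeakBakryEmery C₁ 0)
    (f : DirichletSpace.BddMeas X) (hf : f ∈ G.BV) (t : ℝ) (ht : 0 ≤ t) :
    MeasureTheory.eLpNorm (E.heat t (DirichletSpace.BddMeas.toL2 μ f) - DirichletSpace.BddMeas.toL2 μ f : MeasureTheory.Lp ℝ 2 μ) 1 μ ≤
      ENNReal.ofReal (C₁ ^ 3 * Real.sqrt (2 * t)) * G.variation (DirichletSpace.BddMeas.toL2 μ f) := by
  have hf' : G.variation (DirichletSpace.BddMeas.toL2 μ f) < ∞ := hf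
  have h := G.integral_norm_heat_sub_le hreg hloc (by linarith) hBE hf' ht
  -- The argument yields the factor `C₁`; the cubic one follows from `1 ≤ C₁`.
  have hle : C₁ ≤ C₁ ^ 3 := le_self_pow₀ hC₁ (by norm_num)
  rw [E.heat_eq ht, eLpNorm_one_eq_lintegral_enorm, ← ofReal_integral_norm_eq_lintegral_enorm
    ((Lp.memLp _).integrable one_le_two), ← ENNReal.ofReal_toReal hf'.ne,
    ← ENNReal.ofReal_mul (by positivity)]
  refine ENNReal.ofReal_le_ofReal (h.trans ?_)
  gcongr
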